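/- Let $D\le -3$ be a discriminant, that is, an integer with $D\equiv 0$ or $1 \pmod 4$, not necessarily fundamental. Let $\left(\frac{D}{\cdot}\right)$ be the Kronecker symbol, let $\chi_D$ be the Dirichlet character modulo $|D|$ given by $\chi_D(n)=\left(\frac{D}{n}\right)$ for $n\ge 1$, and let $L(s,\chi_D)$ be its (analytically continued) Dirichlet $L$-function. Then $L(s,\chi_D)$ is differentiable at $s=1$ with $L(1,\chi_D)\neq 0$, the series $\sum_{\left(\frac{D}{p}\right)=-1}\frac{2\log p}{p^2-1}$ over primes $p$ converges absolutely, the series $$\sum_p\frac{\left(\frac{D}{p}\right)\log p}{p-1}=\lim_{x\to\infty}\sum_{p\le x}\frac{\left(\frac{D}{p}\right)\log p}{p-1}$$ over all primes $p$ converges, and $$-\sum_p\frac{\left(\frac{D}{p}\right)\log p}{p-1}=\frac{L'}{L}(1,\chi_D)+\sum_{\left(\frac{D}{p}\right)=-1}\frac{2\log p}{p^2-1}.$$ -/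

import Mathlib

open Filter Topology

/-- The Kronecker symbol `(D/n)` for an integer `D` and a natural number `n`. Writing
`n = 2 ^ e * m` with `m` odd, it is `(D/2) ^ e * (D/m)`, where `(D/m)` is the Jacobi symbol and
`(D/2)` is `0` for even `D`, `1` for `D ≡ ±1 mod 8` and `-1` for `D ≡ ±3 mod 8`; moreover
`(D/0)` is `1` if `D = ±1` and `0` otherwise. -/
def kroneckerSym (D : ℤ) (n : ℕ) : ℤ :=
  if n = 0 then (if D.natAbs = 1 then 1 else 0)
  else ZMod.χ₈ (D : ZMod 8) ^ n.factorization 2 * jacobiSym D (n / 2 ^ n.factorization 2)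

theorem kroneckerSym_one (D : ℤ) : kroneckerSym D 1 = 1 := by
  simp [kroneckerSym]

theorem kroneckerSym_of_odd (D : ℤ) {n : ℕ} (hn : Odd n) : kroneckerSym D n = jacobiSym D n := by
  have h0 : n ≠ 0 := by rintro rfl; simp at hn
  have h2 : n.factorization 2 = 0 :=
    Nat.factorization_eq_zero_of_not_dvd (by rw [← even_iff_two_dvd, Nat.not_even_iff_odd]; exact hn)
  simp [kroneckerSym, h0, h2]

/-- For an odd prime `p` the symbol is the Legendre symbol. -/
theorem kroneckerSym_prime (D : ℤ) (p : ℕ) [Fact p.Prime] (hp : p ≠ 2) :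
    kroneckerSym D p = legendreSym p D := by
  rw [kroneckerSym_of_odd D ((Fact.out : p.Prime).odd_of_ne_two hp), jacobiSym.legendreSym.to_jacobiSym]

theorem kroneckerSym_two (D : ℤ) : kroneckerSym D 2 = ZMod.χ₈ (D : ZMod 8) := by
  have h : (2 : ℕ).factorization 2 = 1 := Nat.Prime.factorization_self Nat.prime_two
  simp [kroneckerSym, h]

theorem kroneckerSym_mul (D : ℤ) (a b : ℕ) (hD : D.natAbs ≠ 1) :
    kroneckerSym D (a * b) = kroneckerSym D a * kroneckerSym D b := by
  by_cases ha : a = 0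
  · simp [kroneckerSym, ha, hD]
  by_cases hb : b = 0
  · simp [kroneckerSym, hb, hD]
  have hab : a * b ≠ 0 := mul_ne_zero ha hb
  have h1 : a / 2 ^ a.factorization 2 ≠ 0 := (Nat.ordCompl_pos 2 ha).ne'
  have h2 : b / 2 ^ b.factorization 2 ≠ 0 := (Nat.ordCompl_pos 2 hb).ne'
  simp only [kroneckerSym, ha, hb, hab, if_false]
  rw [Nat.ordCompl_mul, jacobiSym.mul_right' D h1 h2, Nat.factorization_mul ha hb,
    Finsupp.add_apply, pow_add]
  ring

theorem kroneckerSym_of_even (D : ℤ) {n : ℕ} (hD : Even D) (hn : Even n) (h1 : D.natAbs ≠ 1) :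
    kroneckerSym D n = 0 := by
  by_cases h0 : n = 0
  · simp [kroneckerSym, h0, h1]
  obtain ⟨m, rfl⟩ := even_iff_two_dvd.mp hn
  rw [kroneckerSym_mul D 2 m h1, kroneckerSym_two, ZMod.χ₈_int_eq_if_mod_eight,
    if_pos (Int.even_iff.mp hD), zero_mul]

/-- Reciprocity for negative odd discriminants. -/
theorem kroneckerSym_eq_jacobiSym (D : ℤ) (hD : D ≤ -3) (h4 : D % 4 = 1) (n : ℕ) :
    kroneckerSym D n = jacobiSym n D.natAbs := by
  have h1 : D.natAbs ≠ 1 := by omega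
  by_cases h0 : n = 0
  · subst h0
    simp [kroneckerSym, h1, jacobiSym.zero_left (b := D.natAbs) (by omega)]
  obtain ⟨b, hb⟩ : ∃ b, b = D.natAbs := ⟨_, rfl⟩
  have hDb : D = -(b : ℤ) := by omega
  have hb4 : b % 4 = 3 := by omega
  have hbo : Odd b := Nat.odd_iff.mpr (by omega)
  have two : kroneckerSym D 2 = jacobiSym 2 b := by
    rw [kroneckerSym_two, jacobiSym.at_two hbo, ZMod.χ₈_int_eq_if_mod_eight,
      ZMod.χ₈_nat_eq_if_mod_eight]
    split_ifs <;> first | rfl | omega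
  have odd : ∀ m : ℕ, Odd m → kroneckerSym D m = jacobiSym m b := by
    intro m hm
    rw [kroneckerSym_of_odd D hm, hDb, jacobiSym.neg _ hm]
    rcases Nat.odd_mod_four_iff.mp (Nat.odd_iff.mp hm) with h | h
    · rw [ZMod.χ₄_nat_one_mod_four h, one_mul,
        jacobiSym.quadratic_reciprocity_one_mod_four h hbo]
    · rw [ZMod.χ₄_nat_three_mod_four h,
        jacobiSym.quadratic_reciprocity_three_mod_four hb4 h]
      ring
  rw [← hb]
  induction n using Nat.strong_induction_on with
  | _ n ih =>
    rcases Nat.even_or_odd n with hn | hn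
    · obtain ⟨m, rfl⟩ := even_iff_two_dvd.mp hn
      rw [kroneckerSym_mul D 2 m h1, two, ih m (by omega) (by omega), Nat.cast_mul,
        jacobiSym.mul_left]
      rfl
    · exact odd n hn

theorem kroneckerSym_mod (D : ℤ) (hD : D ≤ -3) (h4 : D % 4 = 0 ∨ D % 4 = 1) (n : ℕ) :
    kroneckerSym D (n % D.natAbs) = kroneckerSym D n := by
  rcases h4 with h4 | h4
  · have h1 : D.natAbs ≠ 1 := by omega
    have hDe : Even D := Int.even_iff.mpr (by omega)
    have he : Even D.natAbs := Int.natAbs_even.mpr hDe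
    rcases Nat.even_or_odd n with hn | hn
    · have hn' : Even (n % D.natAbs) := (Nat.even_iff.mpr (by
        rw [Nat.mod_mod_of_dvd _ (even_iff_two_dvd.mp he)]; exact Nat.even_iff.mp hn))
      rw [kroneckerSym_of_even D hDe hn h1, kroneckerSym_of_even D hDe hn' h1]
    · have hn' : Odd (n % D.natAbs) := hn.mod_even he
      rw [kroneckerSym_of_odd D hn, kroneckerSym_of_odd D hn',
        ← jacobiSym.div_four_left h4 (Nat.odd_iff.mp hn),
        ← jacobiSym.div_four_left h4 (Nat.odd_iff.mp hn'), jacobiSym.mod_right (D / 4) hn]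
      congr 2
      omega
  · rw [kroneckerSym_eq_jacobiSym D hD h4, kroneckerSym_eq_jacobiSym D hD h4,
      jacobiSym.mod_left (n : ℤ)]
    rw [Int.natCast_mod]

theorem kroneckerSym_eq_zero (D : ℤ) (hD : D ≤ -3) (h4 : D % 4 = 0 ∨ D % 4 = 1) (n : ℕ)
    (hn : ¬ n.Coprime D.natAbs) : kroneckerSym D n = 0 := by
  rcases h4 with h4 | h4
  · rcases Nat.even_or_odd n with he | ho
    · exact kroneckerSym_of_even D (Int.even_iff.mpr (by omega)) he (by omega)
    · rw [kroneckerSym_of_odd D ho, jacobiSym.eq_zero_iff]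
      refine ⟨by rintro rfl; simp at ho, fun h => hn ?_⟩
      rw [Int.gcd_eq_natAbs, Int.natAbs_natCast] at h
      exact Nat.Coprime.symm h
  · rw [kroneckerSym_eq_jacobiSym D hD h4, jacobiSym.eq_zero_iff]
    refine ⟨by omega, fun h => hn ?_⟩
    rw [Int.gcd_eq_natAbs, Int.natAbs_natCast, Int.natAbs_natCast] at h
    exact h

/-- The Dirichlet character `χ_D` modulo `|D|` given by `n ↦ (D/n)`, for a negative
discriminant `D` (an integer `D ≤ -3` congruent to `0` or `1` modulo `4`). -/
noncomputable def kroneckerChar (D : ℤ) (hD : D ≤ -3) (h4 : D % 4 = 0 ∨ D % 4 = 1) :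
    DirichletCharacter ℂ D.natAbs where
  toFun a := (kroneckerSym D a.val : ℂ)
  map_one' := by
    have : Fact (1 < D.natAbs) := ⟨by omega⟩
    rw [ZMod.val_one, kroneckerSym_one, Int.cast_one]
  map_mul' a b := by
    have : NeZero D.natAbs := ⟨by omega⟩
    rw [ZMod.val_mul, kroneckerSym_mod D hD h4, kroneckerSym_mul D _ _ (by omega), Int.cast_mul]
  map_nonunit' a ha := by
    have : NeZero D.natAbs := ⟨by omega⟩
    have h : ¬ a.val.Coprime D.natAbs := by
      rw [← ZMod.isUnit_iff_coprime, ZMod.natCast_zmod_val]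
      exact ha
    simp [kroneckerSym_eq_zero D hD h4 _ h]

theorem kroneckerChar_natCast (D : ℤ) (hD : D ≤ -3) (h4 : D % 4 = 0 ∨ D % 4 = 1) (n : ℕ) :
    kroneckerChar D hD h4 (n : ZMod D.natAbs) = (kroneckerSym D n : ℂ) := by
  have : (kroneckerChar D hD h4 (n : ZMod D.natAbs))
      = (kroneckerSym D (n : ZMod D.natAbs).val : ℂ) := rfl
  rw [this, ZMod.val_natCast, kroneckerSym_mod D hD h4]

/-- The Dirichlet `L`-function `L(s, χ_D)`, analytically continued to all complex `s`. -/
noncomputable def kroneckerL (D : ℤ) (hD : D ≤ -3) (h4 : D % 4 = 0 ∨ D % 4 = 1) (s : ℂ) : ℂ :=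
  haveI : NeZero D.natAbs := ⟨by omega⟩
  DirichletCharacter.LFunction (kroneckerChar D hD h4) s

/-!
# A prime sum for the logarithmic derivative of `L(s, χ_D)` at `s = 1`

The character `χ = χ_D` is odd, hence non-trivial, so `L(s, χ)` is entire and does not vanish on
`Re s ≥ 1`. The substance of the theorem is the convergence of the sum over primes, which has the
strength of the prime number theorem for `χ`.

*Tauberian step.* Newman's theorem (`tendsto_sum_div_of_continuousOn`): a Dirichlet series with
coefficients bounded by `1` that extends continuously to `Re s ≥ 1`, differentiably at `1`,
converges at `s = 1`. With `f(t)` the sum of the terms up to `e ^ t` minus the expected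
limit, the Laplace transform of `f` is the difference quotient of the extension at `1`, which is
continuous on the closed half-plane. By Parseval and the Riemann–Lebesgue lemma, `f` smoothed by
the Fourier transform of a compactly supported function tends to `0`. As `f` is Lipschitz up to an
error vanishing at infinity, `f` itself is small once the smoothing is narrow
(`tendsto_zero_of_laplace_continuousOn`). Applied to `1 / L(s, χ)`, this gives
`∑ μ(n) χ(n) / n = 1 / L(1, χ)`.

*Convolution step.* The coefficients `χ(n) Λ(n)` are unbounded, but `χ Λ` is the Dirichlet
convolution of `χ μ` with `χ log`, and `∑ χ(n) log n / n` converges with a power-saving error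
by partial summation. Splitting the divisor sum of the convolution
(`tendsto_sum_convolution_div`) shows that `∑ χ(n) Λ(n) / n` converges; Abel's theorem
(`tendsto_LSeries_nhdsGT_of_tendsto_sum_div`) identifies the sum as `-L'(1, χ) / L(1, χ)`.

*Euler product.* The higher prime powers form an absolutely convergent double series; summing
it geometrically gives `∑ χ(p) log p / (p - χ(p)) = -L'(1, χ) / L(1, χ)`
(`DirichletCharacter.tendsto_sum_prime_mul_log_div_sub`). For `χ(p) ∈ {0, 1}` the denominator may
be replaced by `p - 1`; for `χ(p) = -1` this costs `2 log p / (p ^ 2 - 1)`, whence the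
correction term.
-/

/-! ### A Tauberian theorem for Laplace transforms -/

open MeasureTheory in
open scoped FourierTransform in
theorem integral_fourier_mul_eq {F G : ℝ → ℂ} (hF : Integrable F) (hG : Integrable G) :
    ∫ y, 𝓕 F y * G y = ∫ x, F x * 𝓕 G x := by
  simpa using! (VectorFourier.integral_fourierIntegral_smul_eq_flip (L := innerₗ ℝ)
    Real.continuous_fourierChar continuous_inner hF hG)

open scoped FourierTransform in
theorem fourier_mul_exp (ψ : ℝ → ℂ) (T t : ℝ) :
    𝓕 (fun y : ℝ ↦ ψ y * Complex.exp (2 * Real.pi * y * T * Complex.I)) t = 𝓕 ψ (t - T) := by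
  rw [Real.fourier_real_eq_integral_exp_smul, Real.fourier_real_eq_integral_exp_smul]
  refine MeasureTheory.integral_congr_ae (.of_forall fun y ↦ ?_)
  simp only [smul_eq_mul]
  rw [mul_comm (ψ y), ← mul_assoc, ← Complex.exp_add]
  congr 2
  push_cast
  ring

open MeasureTheory in
theorem integrable_mul_exp_neg_of_linear_growth {f : ℝ → ℂ} (hfm : Measurable f)
    (hf0 : ∀ t < 0, f t = 0) {C : ℝ} (hfC : ∀ t, ‖f t‖ ≤ C * (1 + |t|)) {z : ℂ} (hz : 0 < z.re) :
    Integrable (fun t : ℝ ↦ f t * Complex.exp (-(z * t))) := by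
  have key : IntegrableOn (fun t : ℝ ↦ C * (1 + t ^ (1 : ℝ)) * Real.exp (-z.re * t))
      (Set.Ioi 0) := by
    have h1 := integrableOn_rpow_mul_exp_neg_mul_rpow (s := 1) (p := 1) (by norm_num) one_pos hz
    have h0 := integrableOn_rpow_mul_exp_neg_mul_rpow (s := 0) (p := 1) (by norm_num) one_pos hz
    refine ((h0.add h1).const_mul C).congr (.of_forall fun t ↦ ?_)
    simp
    ring
  have : IntegrableOn (fun t : ℝ ↦ f t * Complex.exp (-(z * t))) (Set.Ici 0) := by
    rw [integrableOn_Ici_iff_integrableOn_Ioi]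
    refine key.mono' (by fun_prop) ?_
    refine (ae_restrict_iff' measurableSet_Ioi).2 (.of_forall fun t (ht : 0 < t) ↦ ?_)
    rw [norm_mul, Complex.norm_exp, Real.rpow_one]
    have : (-(z * t)).re = -z.re * t := by simp
    rw [this]
    have := hfC t
    rw [abs_of_pos ht] at this
    gcongr
  refine (integrableOn_iff_integrable_of_support_subset fun t ht ↦ ?_).1 this
  by_contra h
  exact ht (by simp [hf0 t (not_le.1 h)])

open MeasureTheory in
open scoped FourierTransform SchwartzMap in
/-- The smoothed mean `∫ f(t) ψ̂(t - T) dt` of `f` tends to `0`: by Parseval it equals the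
Fourier integral of the continuous compactly supported function `y ↦ ψ(y) g(2πiy)`, to which the
Riemann–Lebesgue lemma applies. -/
theorem tendsto_integral_mul_fourier_of_laplace {f : ℝ → ℂ} (hfm : Measurable f)
    (hf0 : ∀ t < 0, f t = 0) {C : ℝ} (hfC : ∀ t, ‖f t‖ ≤ C * (1 + |t|))
    {g : ℂ → ℂ} (hg : ContinuousOn g {z | 0 ≤ z.re})
    (hL : ∀ z : ℂ, 0 < z.re → g z = ∫ t : ℝ, f t * Complex.exp (-(z * t)))
    (ψ : 𝓢(ℝ, ℂ)) (hψ : HasCompactSupport ψ) :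
    Tendsto (fun T : ℝ ↦ ∫ t, f t * 𝓕 ψ (t - T)) atTop (𝓝 0) := by
  have hC : 0 ≤ C := by simpa using (norm_nonneg _).trans (hfC 0)
  have hz (ε y : ℝ) : (ε + 2 * Real.pi * y * Complex.I : ℂ).re = ε := by simp
  have hK := (𝓕 ψ).integrable_pow_mul volume 0
  have hK1 := (𝓕 ψ).integrable_pow_mul volume 1
  -- the weight `f(t) ψ̂(t - T)` is absolutely integrable
  have hdom (T : ℝ) : Integrable (fun t ↦ C * (1 + |t|) * ‖𝓕 ψ (t - T)‖) := by
    have : Integrable (fun u ↦ C * (1 + |T| + |u|) * ‖𝓕 ψ u‖) := by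
      refine ((hK.const_mul (C * (1 + |T|))).add (hK1.const_mul C)).congr (.of_forall fun u ↦ ?_)
      simp
      ring
    refine (this.comp_sub_right T).mono' (by fun_prop) (.of_forall fun t ↦ ?_)
    rw [Real.norm_of_nonneg (by positivity)]
    have : |t| ≤ |T| + |t - T| := by
      calc |t| = |T + (t - T)| := by ring_nf
        _ ≤ _ := abs_add_le _ _
    have : 1 + |t| ≤ 1 + |T| + |t - T| := by linarith
    gcongr
  -- continuity of `g` along a compact piece of the closed half-plane
  obtain ⟨M, hM⟩ : ∃ M, ∀ ε ∈ Set.Icc (0 : ℝ) 1, ∀ y ∈ tsupport ψ,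
      ‖g (ε + 2 * Real.pi * y * Complex.I)‖ ≤ M := by
    have hc : IsCompact (Set.Icc (0 : ℝ) 1 ×ˢ tsupport ψ) := isCompact_Icc.prod hψ
    have hcont : ContinuousOn
        (fun p : ℝ × ℝ ↦ g (p.1 + 2 * Real.pi * p.2 * Complex.I))
        (Set.Icc (0 : ℝ) 1 ×ˢ tsupport ψ) := by
      refine hg.comp (by fun_prop) fun p hp ↦ ?_
      simpa using hp.1.1
    obtain ⟨M, hM⟩ := hc.exists_bound_of_continuousOn hcont
    exact ⟨M, fun ε hε y hy ↦ hM (ε, y) ⟨hε, hy⟩⟩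
  have hgcont (ε : ℝ) (hε : 0 ≤ ε) :
      Continuous fun y : ℝ ↦ g (ε + 2 * Real.pi * y * Complex.I) :=
    hg.comp_continuous (by fun_prop) fun y ↦ by simpa using hε
  have hpars (T : ℝ) : ∫ t, f t * 𝓕 ψ (t - T) =
      𝓕 (fun y : ℝ ↦ ψ y * g (2 * Real.pi * y * Complex.I)) (-T) := by
    -- Parseval at abscissa `ε > 0`
    have hε (ε : ℝ) (hε : 0 < ε) :
        ∫ y : ℝ, g (ε + 2 * Real.pi * y * Complex.I) *
          (ψ y * Complex.exp (2 * Real.pi * y * T * Complex.I)) =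
        ∫ t : ℝ, f t * Complex.exp (-(ε * t)) * 𝓕 ψ (t - T) := by
      have hG : Integrable fun y : ℝ ↦ ψ y * Complex.exp (2 * Real.pi * y * T * Complex.I) := by
        refine ψ.integrable.norm.mono' (by fun_prop) (.of_forall fun y ↦ ?_)
        rw [norm_mul, Complex.norm_exp]
        simp
      have := integral_fourier_mul_eq 
        (integrable_mul_exp_neg_of_linear_growth hfm hf0 hfC
          (by simpa using hε : 0 < (ε : ℂ).re)) hG
      simp_rw [fourier_mul_exp] at this
      rw [SchwartzMap.fourier_coe, ← this]
      refine integral_congr_ae (.of_forall fun y ↦ ?_)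
      simp only
      rw [hL _ (by rwa [hz]), Real.fourier_real_eq_integral_exp_smul]
      congr 1
      refine integral_congr_ae (.of_forall fun t ↦ ?_)
      simp only [smul_eq_mul]
      rw [mul_left_comm, ← Complex.exp_add]
      congr 2
      push_cast
      ring
    have l1 : Tendsto (fun ε : ℝ ↦ ∫ y : ℝ, g (ε + 2 * Real.pi * y * Complex.I) *
          (ψ y * Complex.exp (2 * Real.pi * y * T * Complex.I))) (𝓝[>] 0)
        (𝓝 (∫ y : ℝ, g ((0 : ℝ) + 2 * Real.pi * y * Complex.I) *
          (ψ y * Complex.exp (2 * Real.pi * y * T * Complex.I)))) := by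
      have hmem : ∀ᶠ ε : ℝ in 𝓝[>] 0, ε ∈ Set.Ioc (0 : ℝ) 1 := Ioc_mem_nhdsGT one_pos
      refine tendsto_integral_filter_of_dominated_convergence (fun y ↦ M * ‖ψ y‖) ?_ ?_
        (ψ.integrable.norm.const_mul M) (.of_forall fun y ↦ ?_)
      · filter_upwards [hmem] with ε hε
        exact ((hgcont ε hε.1.le).mul (by fun_prop)).aestronglyMeasurable
      · filter_upwards [hmem] with ε hε
        refine .of_forall fun y ↦ ?_
        have he : ‖Complex.exp (2 * Real.pi * y * T * Complex.I)‖ = 1 := by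
          rw [Complex.norm_exp]
          simp
        rw [norm_mul, norm_mul, he, mul_one]
        by_cases hy : y ∈ tsupport ψ
        · exact mul_le_mul_of_nonneg_right (hM ε ⟨hε.1.le, hε.2⟩ y hy) (norm_nonneg _)
        · simp [image_eq_zero_of_notMem_tsupport hy]
      · refine Tendsto.mul_const _ ?_
        refine (hg _ (by simp : (0 : ℝ) ≤ _)).tendsto.comp ?_
        refine tendsto_nhdsWithin_iff.2 ⟨?_, ?_⟩
        · exact (Continuous.tendsto (by fun_prop) 0).mono_left nhdsWithin_le_nhds
        · filter_upwards [hmem] with ε hε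
          simpa using hε.1.le
    have l2 : Tendsto (fun ε : ℝ ↦ ∫ t : ℝ, f t * Complex.exp (-(ε * t)) * 𝓕 ψ (t - T)) (𝓝[>] 0)
        (𝓝 (∫ t : ℝ, f t * Complex.exp (-((0 : ℝ) * t)) * 𝓕 ψ (t - T))) := by
      refine tendsto_integral_filter_of_dominated_convergence
        (fun t ↦ C * (1 + |t|) * ‖𝓕 ψ (t - T)‖) (.of_forall fun ε ↦ ?_) ?_ (hdom T)
        (.of_forall fun t ↦ ?_)
      · exact (by fun_prop : Measurable _).aestronglyMeasurable
      · filter_upwards [self_mem_nhdsWithin] with ε (hε : 0 < ε)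
        refine .of_forall fun t ↦ ?_
        rw [norm_mul, norm_mul, Complex.norm_exp]
        refine mul_le_mul_of_nonneg_right ?_ (norm_nonneg _)
        rcases lt_or_ge t 0 with ht | ht
        · rw [hf0 t ht, norm_zero, zero_mul]
          positivity
        · refine (mul_le_of_le_one_right (norm_nonneg _) ?_).trans (hfC t)
          simp
          positivity
      · exact (Continuous.tendsto (by fun_prop) 0).mono_left nhdsWithin_le_nhds
    have heq := tendsto_nhds_unique
      (l1.congr' (by filter_upwards [self_mem_nhdsWithin] with ε h using hε ε h)) l2
    simp only [Complex.ofReal_zero, zero_mul, neg_zero, Complex.exp_zero, mul_one,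
      zero_add] at heq
    rw [← heq, Real.fourier_real_eq_integral_exp_smul]
    refine integral_congr_ae (.of_forall fun y ↦ ?_)
    simp only [smul_eq_mul]
    rw [← mul_assoc, mul_comm, mul_comm (g _)]
    congr 2
    push_cast
    ring
  simp_rw [hpars]
  exact (Real.zero_at_infty_fourier _).comp
    (tendsto_neg_atTop_atBot.mono_right atBot_le_cocompact)

open scoped SchwartzMap in
theorem exists_schwartzMap_hasCompactSupport_apply_zero_eq_one :
    ∃ ψ : 𝓢(ℝ, ℂ), HasCompactSupport ψ ∧ ψ 0 = 1 := by
  let b : ContDiffBump (0 : ℝ) := ⟨1, 2, one_pos, one_lt_two⟩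
  have h1 : HasCompactSupport fun x ↦ (b x : ℂ) :=
    b.hasCompactSupport.comp_left (g := ((↑) : ℝ → ℂ)) Complex.ofReal_zero
  have h2 : ContDiff ℝ ((⊤ : ℕ∞) : WithTop ℕ∞) fun x ↦ (b x : ℂ) :=
    Complex.ofRealCLM.contDiff.comp b.contDiff
  refine ⟨h1.toSchwartzMap h2, h1, ?_⟩
  have : b 0 = 1 := b.one_of_mem_closedBall (Metric.mem_closedBall_self b.rIn_pos.le)
  simpa using! congrArg ((↑) : ℝ → ℂ) this

open MeasureTheory in
open scoped FourierTransform SchwartzMap in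
/-- A Tauberian estimate at a fixed scale: the constant `A` depends only on the smoothing kernel,
so that a slowly oscillating function (small `δ`) is eventually small. -/
theorem exists_eventually_norm_le_of_laplace : ∃ A : ℝ, 0 < A ∧ ∀ (f : ℝ → ℂ) (η : ℝ → ℝ)
    (δ B : ℝ) (g : ℂ → ℂ), Measurable f → Measurable η → (∀ t < 0, f t = 0) → 0 < δ →
    (∀ t, 0 ≤ η t) → (∀ t, η t ≤ B) → Tendsto η atTop (𝓝 0) →
    (∀ s t, ‖f s - f t‖ ≤ δ * |s - t| + η s + η t) →
    ContinuousOn g {z | 0 ≤ z.re} →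
    (∀ z : ℂ, 0 < z.re → g z = ∫ t : ℝ, f t * Complex.exp (-(z * t))) →
    ∀ᶠ T in atTop, ‖f T‖ ≤ A * δ := by
  obtain ⟨ψ, hψ, hψ0⟩ := exists_schwartzMap_hasCompactSupport_apply_zero_eq_one
  have hK := (𝓕 ψ).integrable_pow_mul volume 0
  have hK1 := (𝓕 ψ).integrable_pow_mul volume 1
  simp only [pow_zero, one_mul, pow_one, Real.norm_eq_abs] at hK hK1
  have hKint : ∫ u, 𝓕 ψ u = 1 := by
    have := congrFun (ψ.continuous.fourierInv_fourier_eq ψ.integrable (𝓕 ψ).integrable) 0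
    rw [Real.fourierInv_eq] at this
    simpa [hψ0] using! this
  have hI : 0 ≤ ∫ u, |u| * ‖𝓕 ψ u‖ := integral_nonneg fun u ↦ by positivity
  refine ⟨(∫ u, |u| * ‖𝓕 ψ u‖) + 1, by positivity, ?_⟩
  intro f η δ B g hfm hηm hf0 hδ hη0 hηB hη hslow hg hL
  have hB : 0 ≤ B := (hη0 0).trans (hηB 0)
  have hfC (t : ℝ) : ‖f t‖ ≤ (δ + 2 * B) * (1 + |t|) := by
    have h := hslow t (-1)
    rw [hf0 (-1) (by norm_num), sub_zero] at h
    have h1 := hηB t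
    have h2 := hηB (-1)
    have h3 : |t - -1| ≤ |t| + 1 := by simpa using abs_add_le t 1
    have h4 : 0 ≤ B * |t| := by positivity
    have h5 := mul_le_mul_of_nonneg_left h3 hδ.le
    nlinarith
  have hsm := tendsto_integral_mul_fourier_of_laplace hfm hf0 hfC hg hL ψ hψ
  have herr : Tendsto (fun T : ℝ ↦ ∫ u, (η T + η (T + u)) * ‖𝓕 ψ u‖) atTop (𝓝 0) := by
    have : Tendsto (fun T : ℝ ↦ ∫ u, (η T + η (T + u)) * ‖𝓕 ψ u‖) atTop
        (𝓝 (∫ u : ℝ, (0 : ℝ))) := by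
      refine tendsto_integral_filter_of_dominated_convergence (fun u ↦ (B + B) * ‖𝓕 ψ u‖)
        (.of_forall fun T ↦ (by fun_prop : Measurable _).aestronglyMeasurable)
        (.of_forall fun T ↦ .of_forall fun u ↦ ?_) (hK.const_mul _) (.of_forall fun u ↦ ?_)
      · rw [Real.norm_of_nonneg (mul_nonneg (add_nonneg (hη0 _) (hη0 _)) (norm_nonneg _))]
        gcongr <;> exact hηB _
      · have h := (hη.add (hη.comp (tendsto_atTop_add_const_right atTop u tendsto_id))).mul_const
          ‖𝓕 ψ u‖
        simpa using! h
    simpa using this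
  have hbound (T : ℝ) : ‖f T‖ ≤ ‖∫ t, f t * 𝓕 ψ (t - T)‖ + (δ * (∫ u, |u| * ‖𝓕 ψ u‖) +
      ∫ u, (η T + η (T + u)) * ‖𝓕 ψ u‖) := by
    have hshift : ∫ t, f t * 𝓕 ψ (t - T) = ∫ u, f (T + u) * 𝓕 ψ u := by
      rw [← integral_add_left_eq_self _ T]
      simp
    have hint : Integrable fun u ↦ f (T + u) * 𝓕 ψ u := by
      refine ((hK.const_mul ((δ + 2 * B) * (1 + |T|))).add
        (hK1.const_mul (δ + 2 * B))).mono'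
        (by fun_prop : Measurable _).aestronglyMeasurable (.of_forall fun u ↦ ?_)
      rw [norm_mul]
      calc _ ≤ ((δ + 2 * B) * (1 + (|T| + |u|))) * ‖𝓕 ψ u‖ := by
            gcongr
            exact (hfC _).trans (by gcongr; exact abs_add_le _ _)
        _ = _ := by simp; ring
    -- the kernel `ψ̂` has integral `ψ(0) = 1`
    have hsplit : f T = (∫ u, f (T + u) * 𝓕 ψ u) + ∫ u, (f T - f (T + u)) * 𝓕 ψ u := by
      rw [← integral_add hint]
      · simp_rw [sub_mul, add_sub_cancel]
        rw [integral_const_mul, hKint, mul_one]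
      · simp_rw [sub_mul]
        exact ((𝓕 ψ).integrable.const_mul _).sub hint
    have hint2 : Integrable fun u ↦ (η T + η (T + u)) * ‖𝓕 ψ u‖ := by
      refine (hK.const_mul (B + B)).mono' (by fun_prop : Measurable _).aestronglyMeasurable
        (.of_forall fun u ↦ ?_)
      rw [Real.norm_of_nonneg (mul_nonneg (add_nonneg (hη0 _) (hη0 _)) (norm_nonneg _))]
      gcongr <;> exact hηB _
    rw [hshift]
    calc ‖f T‖ = ‖(∫ u, f (T + u) * 𝓕 ψ u) + ∫ u, (f T - f (T + u)) * 𝓕 ψ u‖ := by rw [← hsplit]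
      _ ≤ _ := norm_add_le _ _
      _ ≤ _ := by
        gcongr
        rw [← integral_const_mul, ← integral_add (hK1.const_mul δ) hint2]
        refine norm_integral_le_of_norm_le ((hK1.const_mul δ).add hint2) (.of_forall fun u ↦ ?_)
        rw [norm_mul]
        have := hslow T (T + u)
        rw [show |T - (T + u)| = |u| by rw [sub_add_cancel_left, abs_neg]] at this
        calc _ ≤ (δ * |u| + η T + η (T + u)) * ‖𝓕 ψ u‖ := by gcongr
          _ = _ := by ring
  have h1 : ∀ᶠ T in atTop, ‖∫ t, f t * 𝓕 ψ (t - T)‖ < δ / 2 :=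
    (tendsto_norm_zero.comp hsm).eventually_lt_const (by positivity)
  have h2 := herr.eventually_lt_const (show 0 < δ / 2 by positivity)
  filter_upwards [h1, h2] with T hT1 hT2
  linarith [hbound T]

open MeasureTheory in
/-- A Tauberian theorem of Newman–Ingham type: if `f` is supported on the positive half-line, is
Lipschitz up to an error `η` vanishing at infinity, and its Laplace transform extends continuously
to the closed right half-plane, then `f` tends to `0` at infinity. -/
theorem tendsto_zero_of_laplace_continuousOn {f : ℝ → ℂ} {η : ℝ → ℝ} {B : ℝ} {g : ℂ → ℂ}
    (hfm : Measurable f) (hηm : Measurable η) (hf0 : ∀ t < 0, f t = 0)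
    (hη0 : ∀ t, 0 ≤ η t) (hηB : ∀ t, η t ≤ B) (hη : Tendsto η atTop (𝓝 0))
    (hslow : ∀ s t, ‖f s - f t‖ ≤ |s - t| + η s + η t)
    (hg : ContinuousOn g {z | 0 ≤ z.re})
    (hL : ∀ z : ℂ, 0 < z.re → g z = ∫ t : ℝ, f t * Complex.exp (-(z * t))) :
    Tendsto f atTop (𝓝 0) := by
  obtain ⟨A, hA, key⟩ := exists_eventually_norm_le_of_laplace
  refine Metric.tendsto_nhds.2 fun ε hε ↦ ?_
  -- stretching the variable by `c` turns the Lipschitz constant `1` into `c⁻¹`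
  obtain ⟨c, hc, hcA⟩ : ∃ c : ℝ, 0 < c ∧ A * c⁻¹ < ε := by
    refine ⟨2 * A / ε, by positivity, ?_⟩
    rw [inv_div, mul_div_assoc', mul_comm 2 A, mul_div_mul_left _ _ hA.ne']
    linarith
  have hdiv : Tendsto (fun t : ℝ ↦ t / c) atTop atTop := tendsto_id.atTop_div_const hc
  have := key (fun t ↦ f (t / c)) (fun t ↦ η (t / c)) c⁻¹ B (fun z ↦ c * g (c * z))
    (by fun_prop) (by fun_prop) (fun t ht ↦ hf0 _ (div_neg_of_neg_of_pos ht hc)) (by positivity)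
    (fun t ↦ hη0 _) (fun t ↦ hηB _) (hη.comp hdiv) ?_ ?_ ?_
  · have hmul : Tendsto (fun t : ℝ ↦ c * t) atTop atTop := tendsto_id.const_mul_atTop hc
    filter_upwards [hmul.eventually this] with T hT
    rw [mul_div_cancel_left₀ _ hc.ne'] at hT
    rw [dist_zero_right]
    exact hT.trans_lt hcA
  · intro s t
    refine (hslow _ _).trans_eq ?_
    rw [← sub_div, abs_div, abs_of_pos hc, div_eq_inv_mul]
  · refine continuousOn_const.mul (hg.comp (by fun_prop) fun z (hz : 0 ≤ z.re) ↦ ?_)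
    simpa using mul_nonneg hc.le hz
  · intro z hz
    rw [hL _ (by simpa using mul_pos hc hz)]
    have := Measure.integral_comp_div (fun t : ℝ ↦ f t * Complex.exp (-(c * z * t))) c
    rw [abs_of_pos hc, Complex.real_smul] at this
    rw [← this]
    refine integral_congr_ae (.of_forall fun t ↦ ?_)
    have hc' : (c : ℂ) ≠ 0 := by exact_mod_cast hc.ne'
    simp only
    congr 3
    push_cast
    field_simp

/-! ### Dirichlet series at the point `1` -/

theorem sum_Icc_inv_le_inv_add_log {m n : ℕ} (hm : 1 ≤ m) (hmn : m ≤ n) :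
    ∑ k ∈ Finset.Icc m n, (k : ℝ)⁻¹ ≤ (m : ℝ)⁻¹ + (Real.log n - Real.log m) := by
  induction n, hmn using Nat.le_induction with
  | base => simp
  | succ n hmn ih =>
    rw [Finset.sum_Icc_succ_top (by omega)]
    have hn : (0 : ℝ) < n := by exact_mod_cast (by omega : 0 < n)
    have h := Real.log_le_sub_one_of_pos (show (0 : ℝ) < n / (n + 1 : ℕ) by positivity)
    rw [Real.log_div (by positivity) (by positivity)] at h
    have h2 : (n : ℝ) / (n + 1 : ℕ) - 1 = -((n + 1 : ℕ) : ℝ)⁻¹ := by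
      push_cast
      field_simp
      ring
    linarith

/-- The harmonic sum over the integers in `(x, y]` exceeds `log y - log x` by at most `1 / x`. -/
theorem sum_Ioc_floor_inv_le {s t : ℝ} (hts : t ≤ s) :
    ∑ k ∈ Finset.Ioc ⌊Real.exp t⌋₊ ⌊Real.exp s⌋₊, (k : ℝ)⁻¹ ≤ s - t + Real.exp (-t) := by
  rcases Nat.lt_or_ge ⌊Real.exp t⌋₊ ⌊Real.exp s⌋₊ with h | h
  · have hlt : Real.exp t < (⌊Real.exp t⌋₊ + 1 : ℕ) := by
      exact_mod_cast Nat.lt_floor_add_one (Real.exp t)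
    have key := sum_Icc_inv_le_inv_add_log (m := ⌊Real.exp t⌋₊ + 1) (n := ⌊Real.exp s⌋₊)
      (by omega) h
    rw [Finset.Icc_add_one_left_eq_Ioc] at key
    refine key.trans ?_
    have h1 : ((⌊Real.exp t⌋₊ + 1 : ℕ) : ℝ)⁻¹ ≤ Real.exp (-t) := by
      rw [Real.exp_neg]
      exact inv_anti₀ (Real.exp_pos _) hlt.le
    have h2 : t ≤ Real.log (⌊Real.exp t⌋₊ + 1 : ℕ) :=
      (Real.le_log_iff_exp_le ((Real.exp_pos _).trans hlt)).2 hlt.le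
    have h3 : Real.log ⌊Real.exp s⌋₊ ≤ s :=
      (Real.log_le_iff_le_exp (by exact_mod_cast (by omega : 0 < ⌊Real.exp s⌋₊))).2
        (Nat.floor_le (Real.exp_pos _).le)
    linarith
  · rw [Finset.Ioc_eq_empty (by omega), Finset.sum_empty]
    have := Real.exp_pos (-t)
    linarith

theorem LSeries_one_add_eq_LSeries_div (a : ℕ → ℂ) (z : ℂ) :
    LSeries a (1 + z) = LSeries (fun n ↦ a n / n) z := by
  refine tsum_congr fun n ↦ ?_
  rcases eq_or_ne n 0 with rfl | hn
  · simp
  · have : (n : ℂ) ≠ 0 := by exact_mod_cast hn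
    rw [LSeries.term_of_ne_zero hn, LSeries.term_of_ne_zero hn, Complex.cpow_add _ _ this,
      Complex.cpow_one, div_div]

theorem LSeriesSummable_one_add_iff (a : ℕ → ℂ) (z : ℂ) :
    LSeriesSummable a (1 + z) ↔ LSeriesSummable (fun n ↦ a n / n) z := by
  refine summable_congr fun n ↦ ?_
  rcases eq_or_ne n 0 with rfl | hn
  · simp
  · have : (n : ℂ) ≠ 0 := by exact_mod_cast hn
    rw [LSeries.term_of_ne_zero hn, LSeries.term_of_ne_zero hn, Complex.cpow_add _ _ this,
      Complex.cpow_one, div_div]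

open MeasureTheory in
/-- A Dirichlet series as the Laplace transform of its summatory function. -/
theorem LSeries_eq_mul_laplace (c : ℕ → ℂ) {r : ℝ} (hr : 0 ≤ r) {z : ℂ} (hz : r < z.re)
    (hS : LSeriesSummable c z)
    (hO : (fun n ↦ ∑ k ∈ Finset.Icc 1 n, c k) =O[atTop] fun n ↦ (n : ℝ) ^ r) :
    LSeries c z = z * ∫ u in Set.Ioi (0 : ℝ),
      (∑ k ∈ Finset.Icc 1 ⌊Real.exp u⌋₊, c k) * Complex.exp (-(z * u)) := by
  rw [LSeries_eq_mul_integral c hr hz hS hO]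
  congr 1
  have himg : Real.exp '' Set.Ioi 0 = Set.Ioi 1 := by
    ext x
    constructor
    · rintro ⟨u, hu, rfl⟩
      exact Real.one_lt_exp_iff.2 hu
    · intro (hx : 1 < x)
      exact ⟨Real.log x, Real.log_pos hx, Real.exp_log (by linarith)⟩
  rw [← himg, integral_image_eq_integral_abs_deriv_smul measurableSet_Ioi
    (fun x _ ↦ (Real.hasDerivAt_exp x).hasDerivWithinAt) Real.exp_injective.injOn]
  refine integral_congr_ae (.of_forall fun u ↦ ?_)
  simp only [abs_of_pos (Real.exp_pos u), Complex.real_smul]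
  rw [mul_left_comm]
  congr 1
  rw [Complex.cpow_def_of_ne_zero (by exact_mod_cast (Real.exp_pos u).ne'),
    ← Complex.ofReal_log (Real.exp_pos u).le, Real.log_exp, Complex.ofReal_exp, ← Complex.exp_add]
  congr 1
  ring

theorem measurable_comp_floor_exp (A : ℕ → ℂ) : Measurable fun t : ℝ ↦ A ⌊Real.exp t⌋₊ :=
  (measurable_from_nat (f := A)).comp (Nat.measurable_floor.comp Real.measurable_exp)

section Tauberian

variable {a : ℕ → ℂ}

theorem norm_sum_div_sub_le (ha : ∀ n, ‖a n‖ ≤ 1) {s t : ℝ} (hts : t ≤ s) :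
    ‖(∑ k ∈ Finset.Icc 1 ⌊Real.exp s⌋₊, a k / k) - ∑ k ∈ Finset.Icc 1 ⌊Real.exp t⌋₊, a k / k‖ ≤
      s - t + Real.exp (-t) := by
  have hle : ⌊Real.exp t⌋₊ ≤ ⌊Real.exp s⌋₊ := Nat.floor_mono (Real.exp_le_exp.2 hts)
  have hsub : Finset.Icc 1 ⌊Real.exp s⌋₊ =
      Finset.Icc 1 ⌊Real.exp t⌋₊ ∪ Finset.Ioc ⌊Real.exp t⌋₊ ⌊Real.exp s⌋₊ := by
    ext k
    simp only [Finset.mem_Icc, Finset.mem_union, Finset.mem_Ioc]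
    omega
  rw [hsub, Finset.sum_union (Finset.disjoint_left.2 fun k hk hk' ↦ by
    simp only [Finset.mem_Icc, Finset.mem_Ioc] at hk hk'; omega), add_sub_cancel_left]
  refine (norm_sum_le_of_le _ fun k _ ↦ ?_).trans (sum_Ioc_floor_inv_le hts)
  rw [norm_div, Complex.norm_natCast, div_eq_mul_inv]
  exact mul_le_of_le_one_left (by positivity) (ha k)

theorem norm_sum_div_le (ha : ∀ n, ‖a n‖ ≤ 1) {t : ℝ} (ht : 0 ≤ t) :
    ‖∑ k ∈ Finset.Icc 1 ⌊Real.exp t⌋₊, a k / k‖ ≤ 2 + t := by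
  have h := norm_sum_div_sub_le ha ht
  have h1 : ‖∑ k ∈ Finset.Icc 1 ⌊Real.exp 0⌋₊, a k / k‖ ≤ 1 := by simpa using ha 1
  have := norm_le_norm_sub_add (∑ k ∈ Finset.Icc 1 ⌊Real.exp t⌋₊, a k / k)
    (∑ k ∈ Finset.Icc 1 ⌊Real.exp 0⌋₊, a k / k)
  simp only [neg_zero, Real.exp_zero] at h h1 this
  linarith

theorem isBigO_sum_div (ha : ∀ n, ‖a n‖ ≤ 1) {r : ℝ} (hr : 0 < r) :
    (fun n : ℕ ↦ ∑ k ∈ Finset.Icc 1 n, a k / k) =O[atTop] fun n ↦ (n : ℝ) ^ r := by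
  refine Asymptotics.IsBigO.of_bound (2 + 1 / r) ?_
  filter_upwards [eventually_ge_atTop 1] with n hn
  have hn0 : (0 : ℝ) < n := by exact_mod_cast hn
  have h := norm_sum_div_le ha (Real.log_nonneg (by exact_mod_cast hn : (1 : ℝ) ≤ n))
  rw [Real.exp_log hn0, Nat.floor_natCast] at h
  have h1 := Real.log_le_rpow_div hn0.le hr
  have h2 : 1 ≤ (n : ℝ) ^ r := Real.one_le_rpow (by exact_mod_cast hn) hr.le
  rw [Real.norm_of_nonneg (by positivity), add_mul, one_div_mul_eq_div]
  linarith

open MeasureTheory in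
/-- **Newman's theorem** at the point `s = 1`: a Dirichlet series with bounded coefficients that
extends continuously to `Re s ≥ 1`, differentiably at `1`, converges at `1` to the value of
the extension. -/
theorem tendsto_sum_div_of_continuousOn (ha : ∀ n, ‖a n‖ ≤ 1) {G : ℂ → ℂ}
    (hG : ContinuousOn G {s | 1 ≤ s.re}) (hG1 : DifferentiableAt ℂ G 1)
    (hGa : ∀ s : ℂ, 1 < s.re → G s = LSeries a s) :
    Tendsto (fun N : ℕ ↦ ∑ n ∈ Finset.Icc 1 N, a n / n) atTop (𝓝 (G 1)) := by
  set A : ℕ → ℂ := fun N ↦ ∑ n ∈ Finset.Icc 1 N, a n / n with hA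
  let f : ℝ → ℂ := fun t ↦ if t < 0 then 0 else A ⌊Real.exp t⌋₊ - G 1
  -- on the negative half-line `η` also absorbs the jump of `f` at `0`
  let η : ℝ → ℝ := fun t ↦ if t < 0 then 1 + ‖f 0‖ else Real.exp (-t)
  have hfpos {t : ℝ} (ht : 0 ≤ t) : f t = A ⌊Real.exp t⌋₊ - G 1 := if_neg ht.not_gt
  have hfneg {t : ℝ} (ht : t < 0) : f t = 0 := if_pos ht
  have hηpos {t : ℝ} (ht : 0 ≤ t) : η t = Real.exp (-t) := if_neg ht.not_gt
  have hηneg {t : ℝ} (ht : t < 0) : η t = 1 + ‖f 0‖ := if_pos ht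
  have hmA := measurable_comp_floor_exp A
  have hη0 (t : ℝ) : 0 ≤ η t := by
    simp only [η]
    split_ifs <;> positivity
  -- the slow oscillation of `f`
  have hpp {s t : ℝ} (ht : 0 ≤ t) (hts : t ≤ s) : ‖f s - f t‖ ≤ s - t + Real.exp (-t) := by
    rw [hfpos ht, hfpos (ht.trans hts), sub_sub_sub_cancel_right]
    exact norm_sum_div_sub_le ha hts
  have hle {s t : ℝ} (hts : t ≤ s) : ‖f s - f t‖ ≤ s - t + η t := by
    rcases lt_or_ge t 0 with ht | ht
    · rcases lt_or_ge s 0 with hs | hs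
      · rw [hfneg ht, hfneg hs, sub_zero, norm_zero]
        linarith [hη0 t]
      · rw [hfneg ht, hηneg ht, sub_zero]
        have h1 := hpp le_rfl hs
        have h2 := norm_le_norm_sub_add (f s) (f 0)
        simp only [neg_zero, Real.exp_zero] at h1
        linarith
    · rw [hηpos ht]
      exact hpp ht hts
  have htend : Tendsto f atTop (𝓝 0) := by
    refine tendsto_zero_of_laplace_continuousOn (η := η) (B := 1 + ‖f 0‖)
      (g := fun z ↦ dslope G 1 (1 + z)) ?_ ?_ (fun t ht ↦ hfneg ht) hη0 ?_ ?_ ?_ ?_ ?_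
    · exact Measurable.ite measurableSet_Iio measurable_const (hmA.sub_const _)
    · exact Measurable.ite measurableSet_Iio measurable_const (by fun_prop)
    · intro t
      rcases lt_or_ge t 0 with ht | ht
      · rw [hηneg ht]
      · rw [hηpos ht]
        have : Real.exp (-t) ≤ 1 := Real.exp_le_one_iff.2 (by linarith)
        linarith [norm_nonneg (f 0)]
    · refine (Real.tendsto_exp_neg_atTop_nhds_zero).congr' ?_
      filter_upwards [eventually_ge_atTop 0] with t ht using (hηpos ht).symm
    · intro s t
      rcases le_total t s with h | h
      · rw [abs_of_nonneg (sub_nonneg.2 h)]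
        linarith [hle h, hη0 s]
      · rw [abs_sub_comm, abs_of_nonneg (sub_nonneg.2 h), norm_sub_rev]
        linarith [hle h, hη0 t]
    · intro z (hz : 0 ≤ z.re)
      rcases eq_or_ne z 0 with rfl | hz0
      · have h := (continuousAt_dslope_same.2 hG1).comp_of_eq
          (f := fun z : ℂ ↦ 1 + z) (x := 0) (by fun_prop) (by simp)
        exact h.continuousWithinAt
      · have h1 : ContinuousWithinAt (dslope G 1) {s | 1 ≤ s.re} (1 + z) :=
          (continuousWithinAt_dslope_of_ne (by simpa using hz0)).2
            (hG _ (by simpa using hz))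
        exact h1.comp (f := fun z : ℂ ↦ 1 + z) (by fun_prop)
          fun w (hw : 0 ≤ w.re) ↦ by simpa using hw
    · intro z hz
      have hz0 : z ≠ 0 := by rintro rfl; simp at hz
      let F : ℝ → ℂ := fun t ↦ if t < 0 then 0 else A ⌊Real.exp t⌋₊
      have hFint : IntegrableOn (fun t ↦ A ⌊Real.exp t⌋₊ * Complex.exp (-(z * t)))
          (Set.Ioi 0) := by
        have : Integrable (fun t ↦ F t * Complex.exp (-(z * t))) := by
          refine integrable_mul_exp_neg_of_linear_growth (C := 2)
            (Measurable.ite measurableSet_Iio measurable_const hmA) (fun t ht ↦ if_pos ht) ?_ hz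
          intro t
          split_ifs with ht
          · rw [norm_zero]
            positivity
          · rw [abs_of_nonneg (not_lt.1 ht)]
            linarith [norm_sum_div_le ha (not_lt.1 ht)]
        refine (this.integrableOn (s := Set.Ioi 0)).congr_fun (fun t (ht : 0 < t) ↦ ?_)
          measurableSet_Ioi
        simp [F, ht.le.not_gt]
      have hexp : IntegrableOn (fun t : ℝ ↦ Complex.exp (-(z * t))) (Set.Ioi 0) := by
        simpa [neg_mul] using integrableOn_exp_mul_complex_Ioi (a := -z) (by simpa using hz) 0
      have hexpint : ∫ t in Set.Ioi (0 : ℝ), Complex.exp (-(z * t)) = 1 / z := by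
        simpa [neg_mul] using integral_exp_mul_complex_Ioi (a := -z) (by simpa using hz) 0
      have hgt : 1 < (1 + z).re := by simpa using hz
      have hL : G (1 + z) = z * ∫ t in Set.Ioi (0 : ℝ),
          A ⌊Real.exp t⌋₊ * Complex.exp (-(z * t)) := by
        rw [hGa _ hgt, LSeries_one_add_eq_LSeries_div]
        exact LSeries_eq_mul_laplace _ (half_pos hz).le (half_lt_self hz)
          ((LSeriesSummable_one_add_iff a z).1
            (LSeriesSummable_of_bounded_of_one_lt_re (fun n _ ↦ ha n) hgt))
          (isBigO_sum_div ha (half_pos hz))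
      have hfint : ∫ t, f t * Complex.exp (-(z * t)) =
          (∫ t in Set.Ioi (0 : ℝ), A ⌊Real.exp t⌋₊ * Complex.exp (-(z * t))) - G 1 * (1 / z) := by
        rw [← setIntegral_eq_integral_of_forall_compl_eq_zero (s := Set.Ici 0)
          (fun t ht ↦ by rw [hfneg (by simpa using ht), zero_mul]), integral_Ici_eq_integral_Ioi,
          ← hexpint, ← integral_const_mul, ← integral_sub hFint (hexp.const_mul _)]
        refine setIntegral_congr_fun measurableSet_Ioi fun t (ht : 0 < t) ↦ ?_
        rw [hfpos ht.le, sub_mul]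
      rw [hfint, dslope_of_ne _ (by simpa using hz0), slope_def_field, add_sub_cancel_left, hL]
      field_simp
  have hlog : Tendsto (fun N : ℕ ↦ Real.log N) atTop atTop :=
    Real.tendsto_log_atTop.comp tendsto_natCast_atTop_atTop
  have h := (htend.comp hlog).add_const (G 1)
  rw [zero_add] at h
  refine h.congr' ?_
  filter_upwards [eventually_ge_atTop 1] with N hN
  rw [Function.comp_apply, hfpos (Real.log_nonneg (by exact_mod_cast hN)),
    Real.exp_log (by exact_mod_cast hN), Nat.floor_natCast, sub_add_cancel]

end Tauberian

open MeasureTheory in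
/-- Abel's theorem for Dirichlet series at the point `1`. -/
theorem tendsto_LSeries_nhdsGT_of_tendsto_sum_div {a : ℕ → ℂ} {S : ℂ}
    (hlim : Tendsto (fun N : ℕ ↦ ∑ n ∈ Finset.Icc 1 N, a n / n) atTop (𝓝 S))
    (hS : ∀ s : ℂ, 1 < s.re → LSeriesSummable a s) :
    Tendsto (fun x : ℝ ↦ LSeries a (1 + x)) (𝓝[>] 0) (𝓝 S) := by
  set A : ℕ → ℂ := fun N ↦ ∑ n ∈ Finset.Icc 1 N, a n / n with hA
  obtain ⟨M, hM⟩ : ∃ M, ∀ N, ‖A N‖ ≤ M := by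
    obtain ⟨M, hM⟩ := (Metric.isBounded_range_of_tendsto _ hlim).exists_norm_le
    exact ⟨M, fun N ↦ hM _ ⟨N, rfl⟩⟩
  have hexp : IntegrableOn (fun v : ℝ ↦ Real.exp (-v)) (Set.Ioi 0) := integrableOn_exp_neg_Ioi 0
  -- substituting `v = x u` turns the Laplace integral into an average of values `A (e ^ (v / x))`
  have hint (x : ℝ) (hx : 0 < x) : LSeries a (1 + x) =
      ∫ v in Set.Ioi (0 : ℝ), A ⌊Real.exp (x⁻¹ * v)⌋₊ * Real.exp (-v) := by
    rw [LSeries_one_add_eq_LSeries_div, LSeries_eq_mul_laplace _ le_rfl (by simpa using hx)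
      ((LSeriesSummable_one_add_iff a x).1 (hS _ (by simpa using hx)))]
    · have := integral_comp_mul_left_Ioi
        (fun v : ℝ ↦ A ⌊Real.exp (x⁻¹ * v)⌋₊ * (Real.exp (-v) : ℂ)) 0 hx
      rw [mul_zero, Complex.real_smul, eq_comm, Complex.ofReal_inv, inv_mul_eq_iff_eq_mul₀
        (by exact_mod_cast hx.ne')] at this
      rw [this]
      congr 1
      refine integral_congr_ae (.of_forall fun u ↦ ?_)
      simp only [inv_mul_cancel_left₀ hx.ne']
      simp [hA]
    · refine Asymptotics.IsBigO.of_bound M (.of_forall fun N ↦ ?_)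
      simpa using hM N
  have key : Tendsto (fun x : ℝ ↦ ∫ v in Set.Ioi (0 : ℝ),
      A ⌊Real.exp (x⁻¹ * v)⌋₊ * Real.exp (-v)) (𝓝[>] 0)
      (𝓝 (∫ v in Set.Ioi (0 : ℝ), S * Real.exp (-v))) := by
    refine tendsto_integral_filter_of_dominated_convergence (fun v ↦ M * Real.exp (-v))
      (.of_forall fun x ↦ ?_) (.of_forall fun x ↦ .of_forall fun v ↦ ?_) (hexp.const_mul M)
      ((ae_restrict_iff' measurableSet_Ioi).2 (.of_forall fun v (hv : 0 < v) ↦ ?_))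
    · have := (measurable_comp_floor_exp A).comp (measurable_const_mul x⁻¹)
      exact (this.mul (by fun_prop)).aestronglyMeasurable
    · rw [norm_mul, Complex.norm_real, Real.norm_of_nonneg (Real.exp_pos _).le]
      exact mul_le_mul_of_nonneg_right (hM _) (Real.exp_pos _).le
    · refine Tendsto.mul_const _ (hlim.comp (tendsto_nat_floor_atTop.comp
        (Real.tendsto_exp_atTop.comp ?_)))
      exact tendsto_inv_nhdsGT_zero.atTop_mul_const hv
  rw [integral_const_mul, integral_complex_ofReal, integral_exp_neg_Ioi_zero, Complex.ofReal_one,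
    mul_one] at key
  refine key.congr' ?_
  filter_upwards [self_mem_nhdsWithin] with x hx using (hint x hx).symm

/-! ### Dirichlet convolution of convergent series -/

open scoped LSeries.notation in
theorem sum_Icc_convolution_div (a b : ℕ → ℂ) (N : ℕ) :
    ∑ n ∈ Finset.Icc 1 N, (a ⍟ b) n / n =
      ∑ k ∈ Finset.Icc 1 N, a k / k * ∑ m ∈ Finset.Icc 1 (N / k), b m / m := by
  have hex (c : ℕ → ℂ) : ∃ f : ArithmeticFunction ℂ, ∀ n, f n = c n / n :=
    ⟨⟨fun n ↦ c n / n, by simp⟩, fun _ ↦ rfl⟩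
  obtain ⟨f, hf⟩ := hex a
  obtain ⟨g, hg⟩ := hex b
  have h := ArithmeticFunction.sum_Ioc_mul_eq_sum_sum f g N
  have hI (M : ℕ) : Finset.Icc 1 M = Finset.Ioc 0 M := by
    ext
    simp [Nat.one_le_iff_ne_zero, Nat.pos_iff_ne_zero]
  simp only [hI, ← hf, ← hg]
  refine Eq.trans (Finset.sum_congr rfl fun n _ ↦ ?_) h
  rw [ArithmeticFunction.mul_apply, LSeries.convolution_def, Finset.sum_div]
  refine Finset.sum_congr rfl fun p hp ↦ ?_
  rw [hf, hg, div_mul_div_comm, ← (Nat.mem_divisorsAntidiagonal.1 hp).1]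
  push_cast
  rfl

theorem sum_Icc_one_div_sqrt_le (M : ℕ) :
    ∑ k ∈ Finset.Icc 1 M, 1 / √(k : ℝ) ≤ 2 * √M := by
  induction M with
  | zero => simp
  | succ M ih =>
    rw [Finset.sum_Icc_succ_top (by omega)]
    have h0 : (0 : ℝ) ≤ M := by positivity
    have h1 : 0 < √((M : ℝ) + 1) := by positivity
    have h2 := Real.sq_sqrt h0
    have h3 := Real.sq_sqrt (show (0 : ℝ) ≤ (M : ℝ) + 1 by positivity)
    have key : 1 / √((M : ℝ) + 1) ≤ 2 * √((M : ℝ) + 1) - 2 * √M := by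
      rw [div_le_iff₀ h1]
      nlinarith [sq_nonneg (√((M : ℝ) + 1) - √M)]
    push_cast
    linarith

/-- The terms `k` of the divisor sum with `N / k` at least `K` contribute `O(K ^ (-1/2))`. -/
theorem norm_sum_filter_le_of_norm_le_div_sqrt {a E : ℕ → ℂ} {C : ℝ} (ha : ∀ n, ‖a n‖ ≤ 1)
    (hE : ∀ N, 1 ≤ N → ‖E N‖ ≤ C / √N) {K : ℕ} (hK : 1 ≤ K) (N : ℕ) :
    ‖∑ k ∈ (Finset.Icc 1 N).filter (fun k ↦ K ≤ N / k), a k / k * E (N / k)‖ ≤ 4 * C / √K := by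
  have hC : 0 ≤ C := by simpa using (norm_nonneg _).trans (hE 1 le_rfl)
  rcases Nat.eq_zero_or_pos N with rfl | hN
  · simp
    positivity
  have hN' : (0 : ℝ) < N := by exact_mod_cast hN
  have hK' : (0 : ℝ) < K := by exact_mod_cast hK
  have hterm : ∀ k ∈ (Finset.Icc 1 N).filter (fun k ↦ K ≤ N / k),
      ‖a k / k * E (N / k)‖ ≤ 2 * C / √N * (1 / √k) := by
    intro k hk
    simp only [Finset.mem_filter, Finset.mem_Icc] at hk
    have hk0 : (0 : ℝ) < k := by exact_mod_cast hk.1.1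
    have hq : 1 ≤ N / k := hK.trans hk.2
    -- `⌊N / k⌋ ≥ N / (4 k)` as `⌊N / k⌋ ≥ 1`
    have hlow : (N : ℝ) ≤ 4 * (k * (N / k : ℕ)) := by
      have h1 := Nat.lt_mul_div_succ N hk.1.1
      have h2 : k * (N / k + 1) ≤ 4 * (k * (N / k)) := by nlinarith
      exact_mod_cast h1.le.trans h2
    have hsq : √N ≤ 2 * (√k * √(N / k : ℕ)) := by
      rw [← Real.sqrt_mul hk0.le]
      refine Real.sqrt_le_iff.2 ⟨by positivity, ?_⟩
      rw [mul_pow, Real.sq_sqrt (by positivity)]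
      linarith
    have hq0 : (0 : ℝ) < (N / k : ℕ) := by exact_mod_cast hq
    calc ‖a k / k * E (N / k)‖ ≤ 1 / k * (C / √(N / k : ℕ)) := by
          rw [norm_mul, norm_div, Complex.norm_natCast]
          gcongr
          · exact ha k
          · exact hE _ hq
      _ ≤ 2 * C / √N * (1 / √k) := by
          rw [div_mul_div_comm, div_mul_div_comm, div_le_div_iff₀ (by positivity) (by positivity)]
          have hkk : (k : ℝ) = √k * √k := (Real.mul_self_sqrt hk0.le).symm
          calc 1 * C * (√N * √k) ≤ 1 * C * (2 * (√k * √(N / k : ℕ)) * √k) := by gcongr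
            _ = 2 * C * 1 * (√k * √k * √(N / k : ℕ)) := by ring
            _ = _ := by rw [← hkk]
  have hsub : (Finset.Icc 1 N).filter (fun k ↦ K ≤ N / k) ⊆ Finset.Icc 1 (N / K) := by
    intro k hk
    simp only [Finset.mem_filter, Finset.mem_Icc] at hk ⊢
    refine ⟨hk.1.1, (Nat.le_div_iff_mul_le hK).2 ?_⟩
    rw [mul_comm]
    exact (Nat.le_div_iff_mul_le hk.1.1).1 hk.2
  calc _ ≤ ∑ k ∈ (Finset.Icc 1 N).filter (fun k ↦ K ≤ N / k), 2 * C / √N * (1 / √(k : ℝ)) :=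
        norm_sum_le_of_le _ hterm
    _ ≤ ∑ k ∈ Finset.Icc 1 (N / K), 2 * C / √N * (1 / √(k : ℝ)) :=
        Finset.sum_le_sum_of_subset_of_nonneg hsub fun _ _ _ ↦ by positivity
    _ ≤ 2 * C / √N * (2 * √(N / K : ℕ)) := by
        rw [← Finset.mul_sum]
        gcongr
        exact sum_Icc_one_div_sqrt_le _
    _ ≤ 2 * C / √N * (2 * √((N : ℝ) / K)) := by
        gcongr
        exact Nat.cast_div_le
    _ = 4 * C / √K := by
        rw [Real.sqrt_div hN'.le]
        field_simp
        ring

theorem div_succ_lt_and_le_div_iff {N j k : ℕ} (hj : 1 ≤ j) (hk : 1 ≤ k) :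
    N / (j + 1) < k ∧ k ≤ N / j ↔ N / k = j := by
  rw [Nat.div_lt_iff_lt_mul (by omega), Nat.le_div_iff_mul_le hj, Nat.div_eq_iff hk]
  rw [mul_comm k (j + 1), add_mul, one_mul, mul_comm k j]
  omega

/-- The terms `k` of the divisor sum with `N / k` less than `K` form finitely many blocks, each of
which tends to `0` by the Cauchy criterion. -/
theorem tendsto_sum_filter_div_lt {a : ℕ → ℂ} {l : ℂ}
    (hA : Tendsto (fun N : ℕ ↦ ∑ n ∈ Finset.Icc 1 N, a n / n) atTop (𝓝 l)) (E : ℕ → ℂ) (K : ℕ) :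
    Tendsto (fun N : ℕ ↦ ∑ k ∈ (Finset.Icc 1 N).filter (fun k ↦ ¬ K ≤ N / k),
      a k / k * E (N / k)) atTop (𝓝 0) := by
  have hblock (N : ℕ) : ∑ k ∈ (Finset.Icc 1 N).filter (fun k ↦ ¬ K ≤ N / k), a k / k * E (N / k) =
      ∑ j ∈ Finset.Ico 1 K, ((∑ n ∈ Finset.Icc 1 (N / j), a n / n) -
        ∑ n ∈ Finset.Icc 1 (N / (j + 1)), a n / n) * E j := by
    rw [← Finset.sum_fiberwise_of_maps_to (t := Finset.Ico 1 K) (g := fun k ↦ N / k)]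
    · refine Finset.sum_congr rfl fun j hj ↦ ?_
      rw [Finset.mem_Ico] at hj
      have hsub : Finset.Icc 1 (N / (j + 1)) ⊆ Finset.Icc 1 (N / j) :=
        Finset.Icc_subset_Icc_right (Nat.div_le_div_left (by omega) hj.1)
      rw [← Finset.sum_sdiff hsub, add_sub_cancel_right, Finset.sum_mul]
      refine Finset.sum_congr ?_ fun k hk ↦ ?_
      · ext k
        simp only [Finset.mem_filter, Finset.mem_Icc, Finset.mem_sdiff, not_and, not_le]
        constructor
        · rintro ⟨⟨⟨hk1, -⟩, -⟩, hkj⟩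
          have h := (div_succ_lt_and_le_div_iff hj.1 hk1).2 hkj
          exact ⟨⟨hk1, h.2⟩, fun _ ↦ h.1⟩
        · rintro ⟨⟨hk1, hk2⟩, hk3⟩
          have h := (div_succ_lt_and_le_div_iff hj.1 hk1).1 ⟨hk3 hk1, hk2⟩
          exact ⟨⟨⟨hk1, hk2.trans (Nat.div_le_self N j)⟩, by omega⟩, h⟩
      · simp only [Finset.mem_sdiff, Finset.mem_Icc, not_and, not_le] at hk
        rw [(div_succ_lt_and_le_div_iff hj.1 hk.1.1).1 ⟨hk.2 hk.1.1, hk.1.2⟩]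
    · intro k hk
      simp only [Finset.mem_filter, Finset.mem_Icc] at hk
      exact Finset.mem_Ico.2 ⟨Nat.div_pos hk.1.2 hk.1.1, not_le.1 hk.2⟩
  simp_rw [hblock]
  rw [show (0 : ℂ) = ∑ j ∈ Finset.Ico 1 K, (l - l) * E j by simp]
  refine tendsto_finsetSum _ fun j hj ↦ ?_
  have hj1 : j ≠ 0 := by have := (Finset.mem_Ico.1 hj).1; omega
  exact ((hA.comp (Nat.tendsto_div_const_atTop hj1)).sub
    (hA.comp (Nat.tendsto_div_const_atTop (Nat.succ_ne_zero j)))).mul_const _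

open scoped LSeries.notation in
/-- Convergence of the Dirichlet convolution of two series at `s = 1`, one with bounded
coefficients, the other with a power-saving rate of convergence. -/
theorem tendsto_sum_convolution_div {a b : ℕ → ℂ} {l β : ℂ} {C : ℝ} (ha : ∀ n, ‖a n‖ ≤ 1)
    (hA : Tendsto (fun N : ℕ ↦ ∑ n ∈ Finset.Icc 1 N, a n / n) atTop (𝓝 l))
    (hB : ∀ N : ℕ, 1 ≤ N → ‖(∑ n ∈ Finset.Icc 1 N, b n / n) - β‖ ≤ C / √N) :
    Tendsto (fun N : ℕ ↦ ∑ n ∈ Finset.Icc 1 N, (a ⍟ b) n / n) atTop (𝓝 (l * β)) := by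
  set E : ℕ → ℂ := fun N ↦ (∑ n ∈ Finset.Icc 1 N, b n / n) - β with hE
  have hsplit (N : ℕ) : ∑ n ∈ Finset.Icc 1 N, (a ⍟ b) n / n =
      (∑ n ∈ Finset.Icc 1 N, a n / n) * β + ∑ k ∈ Finset.Icc 1 N, a k / k * E (N / k) := by
    rw [sum_Icc_convolution_div, Finset.sum_mul, ← Finset.sum_add_distrib]
    refine Finset.sum_congr rfl fun k _ ↦ ?_
    rw [← mul_add, hE, add_sub_cancel]
  have herr : Tendsto (fun N : ℕ ↦ ∑ k ∈ Finset.Icc 1 N, a k / k * E (N / k)) atTop (𝓝 0) := by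
    refine Metric.tendsto_nhds.2 fun ε hε ↦ ?_
    have hlim : Tendsto (fun K : ℕ ↦ 4 * C / √(K : ℝ)) atTop (𝓝 0) :=
      (Real.tendsto_sqrt_atTop.comp tendsto_natCast_atTop_atTop).const_div_atTop _
    obtain ⟨K, hK1, hK⟩ :=
      ((eventually_ge_atTop 1).and (hlim.eventually_lt_const (half_pos hε))).exists
    have h2 := (tendsto_norm_zero.comp (tendsto_sum_filter_div_lt hA E K)).eventually_lt_const
      (half_pos hε)
    filter_upwards [h2] with N hN
    rw [dist_zero_right, ← Finset.sum_filter_add_sum_filter_not _ (fun k ↦ K ≤ N / k)]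
    have h1 := norm_sum_filter_le_of_norm_le_div_sqrt ha hB hK1 N
    rw [Function.comp_apply] at hN
    refine (norm_add_le _ _).trans_lt ?_
    linarith
  have h := (hA.mul_const β).add herr
  rw [add_zero] at h
  exact h.congr fun N ↦ (hsplit N).symm

/-! ### Partial summation for characters -/

/-- Dirichlet's test with a remainder. -/
theorem norm_sum_Ico_smul_le_of_antitoneOn {w : ℕ → ℝ} {X : ℕ → ℂ} {M : ℝ} {m : ℕ}
    (hw : AntitoneOn w (Set.Ici m)) (hw0 : ∀ n, 0 ≤ w n)
    (hX : ∀ n, ‖∑ i ∈ Finset.range n, X i‖ ≤ M) (n : ℕ) :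
    ‖∑ i ∈ Finset.Ico m n, w i • X i‖ ≤ 2 * M * w m := by
  have hM : 0 ≤ M := (norm_nonneg _).trans (hX 0)
  rcases Nat.lt_or_ge m n with hmn | hmn
  · rw [Finset.sum_Ico_by_parts _ _ hmn]
    have hsum : ‖∑ i ∈ Finset.Ico m (n - 1), (w (i + 1) - w i) • ∑ j ∈ Finset.range (i + 1), X j‖
        ≤ M * (w m - w (n - 1)) := by
      rw [← neg_sub (w (n - 1)), ← Finset.sum_Ico_sub w (by omega : m ≤ n - 1),
        ← Finset.sum_neg_distrib, Finset.mul_sum]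
      refine norm_sum_le_of_le _ fun i hi ↦ ?_
      have hi' := (Finset.mem_Ico.1 hi).1
      have : w (i + 1) ≤ w i := hw hi' (Set.mem_Ici.2 (by omega)) (by omega)
      rw [norm_smul, Real.norm_of_nonpos (by linarith), mul_comm]
      exact mul_le_mul_of_nonneg_right (hX _) (by linarith)
    have h1 : ‖w (n - 1) • ∑ i ∈ Finset.range n, X i‖ ≤ w (n - 1) * M := by
      rw [norm_smul, Real.norm_of_nonneg (hw0 _)]
      exact mul_le_mul_of_nonneg_left (hX _) (hw0 _)
    have h2 : ‖w m • ∑ i ∈ Finset.range m, X i‖ ≤ w m * M := by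
      rw [norm_smul, Real.norm_of_nonneg (hw0 _)]
      exact mul_le_mul_of_nonneg_left (hX _) (hw0 _)
    refine (norm_sub_le _ _).trans ((add_le_add (norm_sub_le _ _) le_rfl).trans ?_)
    linarith
  · rw [Finset.Ico_eq_empty (by omega), Finset.sum_empty, norm_zero]
    have := hw0 m
    positivity

theorem log_div_le_two_div_sqrt {n : ℕ} (hn : 1 ≤ n) : Real.log n / n ≤ 2 / √n := by
  have hn0 : (0 : ℝ) < n := by exact_mod_cast hn
  have h := Real.log_le_rpow_div hn0.le one_half_pos
  rw [← Real.sqrt_eq_rpow] at h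
  rw [div_le_div_iff₀ hn0 (by positivity)]
  have h2 := Real.mul_self_sqrt hn0.le
  have h3 := mul_le_mul_of_nonneg_right h (Real.sqrt_nonneg n)
  linarith

namespace DirichletCharacter

variable {q : ℕ} [NeZero q] {χ : DirichletCharacter ℂ q}

theorem sum_range_modulus_eq_zero (hχ : χ ≠ 1) : ∑ i ∈ Finset.range q, χ i = 0 := by
  rw [← MulChar.sum_eq_zero_of_ne_one hχ]
  refine Finset.sum_nbij' (fun n : ℕ ↦ (n : ZMod q)) ZMod.val (by simp)
    (fun a _ ↦ Finset.mem_range.2 (ZMod.val_lt a)) (fun n hn ↦ ?_) (by simp) (by simp)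
  exact ZMod.val_cast_of_lt (Finset.mem_range.1 hn)

theorem norm_sum_range_le (hχ : χ ≠ 1) (n : ℕ) : ‖∑ i ∈ Finset.range n, χ i‖ ≤ q := by
  have hper : Function.Periodic (fun n : ℕ ↦ ∑ i ∈ Finset.range n, χ i) q := by
    intro n
    simp only
    rw [add_comm, Finset.sum_range_add, sum_range_modulus_eq_zero hχ, zero_add]
    simp
  rw [← hper.map_mod_nat n]
  refine (norm_sum_le_of_le _ fun (i : ℕ) _ ↦ χ.norm_le_one (i : ZMod q)).trans ?_
  simpa using (Nat.mod_lt n (NeZero.pos q)).le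

/-- The series `∑ χ(n) log n / n` converges with error `O(N ^ (-1/2))`. -/
theorem exists_norm_sum_mul_log_div_sub_le (hχ : χ ≠ 1) : ∃ (β : ℂ) (C : ℝ), ∀ N : ℕ, 1 ≤ N →
    ‖(∑ n ∈ Finset.Icc 1 N, χ n * Complex.log n / n) - β‖ ≤ C / √N := by
  set S : ℕ → ℂ := fun N ↦ ∑ n ∈ Finset.Icc 1 N, χ n * Complex.log n / n with hS
  -- `log x / x` decreases from `x = e` on, hence on the integers from `3` on
  have hanti {m : ℕ} (hm : 3 ≤ m) : AntitoneOn (fun n : ℕ ↦ Real.log n / n) (Set.Ici m) := by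
    have hmem {i : ℕ} (hi : m ≤ i) : Real.exp 1 ≤ i := by
      have : (3 : ℝ) ≤ i := by exact_mod_cast hm.trans hi
      linarith [Real.exp_one_lt_three]
    intro i hi j hj hij
    exact Real.log_div_self_antitoneOn (hmem hi) (hmem hj) (by exact_mod_cast hij)
  have htail {N : ℕ} (hN : 2 ≤ N) (P : ℕ) (hP : N ≤ P) : ‖S P - S N‖ ≤ 4 * q / √N := by
    have hdiff : S P - S N = ∑ i ∈ Finset.Ico (N + 1) (P + 1), (Real.log i / i : ℝ) • χ i := by
      have hsub : Finset.Icc 1 N ⊆ Finset.Icc 1 P := Finset.Icc_subset_Icc_right hP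
      rw [hS]
      simp only
      rw [← Finset.sum_sdiff hsub, add_sub_cancel_right]
      refine Finset.sum_congr ?_ fun i _ ↦ ?_
      · ext i
        simp only [Finset.mem_sdiff, Finset.mem_Icc, Finset.mem_Ico]
        omega
      · rw [Complex.real_smul, Complex.ofReal_div, Complex.natCast_log, Complex.ofReal_natCast]
        ring
    rw [hdiff]
    refine (norm_sum_Ico_smul_le_of_antitoneOn (hanti (by omega))
      (fun n ↦ div_nonneg (Real.log_natCast_nonneg n) n.cast_nonneg) (norm_sum_range_le hχ) _).trans
      ?_
    have h1 : Real.log (N + 1 : ℕ) / (N + 1 : ℕ) ≤ 2 / √(N : ℝ) := by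
      refine (log_div_le_two_div_sqrt (by omega)).trans ?_
      have : (0 : ℝ) < N := by exact_mod_cast (by omega : 0 < N)
      gcongr
      omega
    calc _ ≤ 2 * (q : ℝ) * (2 / √(N : ℝ)) := by gcongr
      _ = _ := by ring
  have hcauchy : CauchySeq S := by
    refine Metric.cauchySeq_iff'.2 fun ε hε ↦ ?_
    have hlim : Tendsto (fun N : ℕ ↦ 4 * q / √(N : ℝ)) atTop (𝓝 0) :=
      (Real.tendsto_sqrt_atTop.comp tendsto_natCast_atTop_atTop).const_div_atTop _
    obtain ⟨N, hN, hNε⟩ := ((eventually_ge_atTop 2).and (hlim.eventually_lt_const hε)).exists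
    exact ⟨N, fun P hP ↦ (dist_eq_norm (S P) (S N)).trans_lt ((htail hN P hP).trans_lt hNε)⟩
  obtain ⟨β, hβ⟩ := cauchySeq_tendsto_of_complete hcauchy
  have hrate {N : ℕ} (hN : 2 ≤ N) : ‖S N - β‖ ≤ 4 * q / √N := by
    rw [norm_sub_rev]
    refine le_of_tendsto (hβ.sub_const (S N)).norm ?_
    filter_upwards [eventually_ge_atTop N] with P hP using htail hN P hP
  -- the tail estimate needs `N ≥ 2`; the extra summand covers `N = 1`
  refine ⟨β, 4 * q + ‖S 1 - β‖, fun N hN ↦ ?_⟩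
  rcases hN.eq_or_lt with rfl | hN
  · rw [Nat.cast_one, Real.sqrt_one, div_one]
    exact le_add_of_nonneg_left (by positivity)
  · refine (hrate hN).trans ?_
    gcongr
    exact le_add_of_nonneg_right (norm_nonneg _)

end DirichletCharacter

/-! ### The prime number theorem for a character -/

namespace DirichletCharacter

open scoped LSeries.notation ArithmeticFunction.Moebius ArithmeticFunction.vonMangoldt

theorem convolution_moebius_log :
    (fun n : ℕ ↦ (μ n : ℂ)) ⍟ (fun n : ℕ ↦ Complex.log n) = fun n : ℕ ↦ (Λ n : ℂ) := by
  ext n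
  rw [LSeries.convolution_def, ← ArithmeticFunction.moebius_mul_log_eq_vonMangoldt,
    ArithmeticFunction.mul_apply]
  push_cast
  refine Finset.sum_congr rfl fun p _ ↦ ?_
  rw [ArithmeticFunction.log_apply, Complex.natCast_log]
  simp

theorem norm_mul_moebius_le_one {q : ℕ} (χ : DirichletCharacter ℂ q) (n : ℕ) :
    ‖χ n * (μ n : ℂ)‖ ≤ 1 := by
  rw [norm_mul, Complex.norm_intCast]
  exact mul_le_one₀ (χ.norm_le_one _) (abs_nonneg _)
    (by exact_mod_cast ArithmeticFunction.abs_moebius_le_one)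

variable {q : ℕ} [NeZero q] {χ : DirichletCharacter ℂ q}

/-- The prime number theorem for `χ` in the form `∑ μ(n) χ(n) / n = 1 / L(1, χ)`. -/
theorem tendsto_sum_mul_moebius_div (hχ : χ ≠ 1) :
    Tendsto (fun N : ℕ ↦ ∑ n ∈ Finset.Icc 1 N, χ n * (μ n : ℂ) / n) atTop
      (𝓝 (LFunction χ 1)⁻¹) := by
  have hdiff (s : ℂ) (hs : 1 ≤ s.re) : DifferentiableAt ℂ (fun s ↦ (LFunction χ s)⁻¹) s :=
    (differentiable_LFunction hχ s).fun_inv (LFunction_ne_zero_of_one_le_re χ (.inl hχ) hs)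
  refine tendsto_sum_div_of_continuousOn (a := fun n ↦ χ n * (μ n : ℂ))
    (G := fun s ↦ (LFunction χ s)⁻¹) (norm_mul_moebius_le_one χ)
    (fun s hs ↦ (hdiff s hs).continuousAt.continuousWithinAt) (hdiff 1 (by simp)) fun s hs ↦ ?_
  rw [LFunction_eq_LSeries χ hs]
  exact inv_eq_of_mul_eq_one_right (LSeries.mul_mu_eq_one χ hs)

/-- The prime number theorem for `χ` in the form `∑ χ(n) Λ(n) / n = -L'(1, χ) / L(1, χ)`. -/
theorem tendsto_sum_mul_vonMangoldt_div (hχ : χ ≠ 1) :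
    Tendsto (fun N : ℕ ↦ ∑ n ∈ Finset.Icc 1 N, χ n * (Λ n : ℂ) / n) atTop
      (𝓝 (-(deriv (LFunction χ) 1 / LFunction χ 1))) := by
  obtain ⟨β, C, hβ⟩ := exists_norm_sum_mul_log_div_sub_le hχ
  have hconv : (fun n : ℕ ↦ χ n * (μ n : ℂ)) ⍟ (fun n : ℕ ↦ χ n * Complex.log n) =
      fun n : ℕ ↦ χ n * (Λ n : ℂ) := by
    have h := χ.mul_convolution_distrib (fun n : ℕ ↦ (μ n : ℂ)) (fun n : ℕ ↦ Complex.log n)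
    rw [convolution_moebius_log] at h
    exact h
  have hlim := tendsto_sum_convolution_div (norm_mul_moebius_le_one χ)
    (tendsto_sum_mul_moebius_div hχ) hβ
  rw [hconv] at hlim
  -- the limit exists, so Abel's theorem identifies it without computing `β`
  have habel := tendsto_LSeries_nhdsGT_of_tendsto_sum_div hlim
    fun s hs ↦ LSeriesSummable_twist_vonMangoldt χ hs
  have hd := differentiable_LFunction hχ
  have hcont : ContinuousAt (fun s ↦ -(deriv (LFunction χ) s / LFunction χ s)) 1 :=
    ((hd.contDiff (n := 1)).continuous_deriv le_rfl).continuousAt.div hd.continuous.continuousAt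
      (LFunction_apply_one_ne_zero hχ) |>.neg
  have hline : Tendsto (fun x : ℝ ↦ (1 + x : ℂ)) (𝓝[>] 0) (𝓝 1) := by
    have : ContinuousAt (fun x : ℝ ↦ (1 + x : ℂ)) 0 := by fun_prop
    simpa [ContinuousAt] using this.tendsto.mono_left nhdsWithin_le_nhds
  have heq := tendsto_nhds_unique (habel.congr' ?_) (hcont.tendsto.comp hline)
  · rwa [heq] at hlim
  · filter_upwards [self_mem_nhdsWithin] with x (hx : 0 < x)
    have hs : 1 < (1 + x : ℂ).re := by simpa using hx
    rw [Function.comp_apply, deriv_LFunction_eq_deriv_LSeries χ hs, LFunction_eq_LSeries χ hs,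
      ← neg_div]
    exact LSeries_twist_vonMangoldt_eq χ hs

end DirichletCharacter

/-! ### From prime powers to primes -/

theorem HasSum.tendsto_sum_Icc_one {g : ℕ → ℂ} {H : ℂ} (hg : HasSum g H) (h0 : g 0 = 0) :
    Tendsto (fun N : ℕ ↦ ∑ n ∈ Finset.Icc 1 N, g n) atTop (𝓝 H) := by
  refine ((tendsto_add_atTop_iff_nat 1).2 hg.tendsto_sum_nat).congr fun N ↦ ?_
  rw [Finset.range_eq_Ico, ← Finset.sum_sdiff (s₁ := Finset.Icc 1 N), add_eq_right]
  · refine Finset.sum_eq_zero fun n hn ↦ ?_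
    simp only [Finset.mem_sdiff, Finset.mem_Ico, Finset.mem_Icc] at hn
    rw [show n = 0 by omega, h0]
  · intro n hn
    simp only [Finset.mem_Ico, Finset.mem_Icc] at hn ⊢
    omega

namespace DirichletCharacter

open scoped ArithmeticFunction.vonMangoldt

theorem summable_mul_vonMangoldt_nonprime {q : ℕ} (χ : DirichletCharacter ℂ q) :
    Summable fun n : ℕ ↦ if n.Prime then 0 else χ n * (Λ n : ℂ) / n := by
  have h := ArithmeticFunction.vonMangoldt.summable_residueClass_non_primes_div (q := 1) (a := 0)
  refine h.of_norm_bounded fun n ↦ ?_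
  split_ifs with hn
  · simp
  · have hΛ : ArithmeticFunction.vonMangoldt.residueClass (0 : ZMod 1) n = Λ n :=
      
      Set.indicator_of_mem (s := {n : ℕ | (n : ZMod 1) = 0}) (Subsingleton.elim _ _) _
    rw [hΛ, norm_div, norm_mul, Complex.norm_natCast, Complex.norm_real,
      Real.norm_of_nonneg ArithmeticFunction.vonMangoldt_nonneg]
    gcongr
    exact mul_le_of_le_one_left ArithmeticFunction.vonMangoldt_nonneg (χ.norm_le_one _)

theorem injective_prime_pow_add_two :
    Function.Injective fun pk : {p : ℕ // p.Prime} × ℕ ↦ (pk.1 : ℕ) ^ (pk.2 + 2) := by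
  rintro ⟨p, k⟩ ⟨p', k'⟩ h
  obtain ⟨h1, h2⟩ := p.2.pow_inj' p'.2 (by omega) (by omega) h
  exact Prod.ext (Subtype.ext h1) (by simpa using h2)

/-- The higher prime powers, summed as geometric series. -/
theorem hasSum_prime_pow {q : ℕ} (χ : DirichletCharacter ℂ q) :
    HasSum (fun n : ℕ ↦ if n.Prime then χ n ^ 2 * Real.log n / (n * (n - χ n)) else 0)
      (∑' n : ℕ, if n.Prime then 0 else χ n * (Λ n : ℂ) / n) := by
  have h := (summable_mul_vonMangoldt_nonprime χ).hasSum
  rw [← injective_prime_pow_add_two.hasSum_iff] at h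
  · have hfib (p : {p : ℕ // p.Prime}) : HasSum (fun k : ℕ ↦
        (fun n : ℕ ↦ if n.Prime then 0 else χ n * (Λ n : ℂ) / n) ((p : ℕ) ^ (k + 2)))
        (χ p ^ 2 * Real.log p / (p * (p - χ p))) := by
      have hp0 : (p : ℂ) ≠ 0 := by exact_mod_cast p.2.ne_zero
      have hp1 : (1 : ℝ) < p := by exact_mod_cast p.2.one_lt
      have hlt : ‖χ p / p‖ < 1 := by
        rw [norm_div, Complex.norm_natCast, div_lt_one (by linarith)]
        exact (χ.norm_le_one _).trans_lt hp1
      have hne : (p : ℂ) - χ p ≠ 0 := by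
        intro h0
        rw [← sub_eq_zero.1 h0, div_self hp0, norm_one] at hlt
        exact lt_irrefl _ hlt
      have hgeo := (hasSum_geometric_of_norm_lt_one hlt).mul_left (Real.log p * (χ p / p) ^ 2)
      convert! hgeo using 1
      · ext k
        simp only
        rw [if_neg (Nat.Prime.not_prime_pow (by omega)),
          ArithmeticFunction.vonMangoldt_apply_pow (by omega),
          ArithmeticFunction.vonMangoldt_apply_prime p.2]
        push_cast
        rw [map_pow, div_pow, div_pow]
        field_simp
        ring
      · rw [show (1 : ℂ) - χ p / p = (p - χ p) / p by field_simp]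
        field_simp
    have h2 := h.prod_fiberwise hfib
    have h3 := (hasSum_subtype_iff_indicator (s := {n : ℕ | n.Prime})
      (f := fun n : ℕ ↦ χ n ^ 2 * Real.log n / (n * (n - χ n)))).1 h2
    convert! h3 using 1
    ext n
    simp [Set.indicator_apply]
  · intro n hn
    split_ifs with hp
    · rfl
    · have : ¬ IsPrimePow n := by
        intro hpp
        obtain ⟨p, k, hp', hk, rfl⟩ := (isPrimePow_nat_iff n).1 hpp
        obtain rfl | hk2 : k = 1 ∨ 2 ≤ k := by omega
        · exact hp (by simpa using hp')
        · exact hn ⟨(⟨p, hp'⟩, k - 2), by simp [Nat.sub_add_cancel hk2]⟩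
      rw [ArithmeticFunction.vonMangoldt_eq_zero_iff.2 this]
      simp

/-- The logarithmic derivative at `1` of the Euler product of `L(s, χ)`. -/
theorem tendsto_sum_prime_mul_log_div_sub {q : ℕ} [NeZero q] {χ : DirichletCharacter ℂ q}
    (hχ : χ ≠ 1) :
    Tendsto (fun N : ℕ ↦ ∑ p ∈ (Finset.Icc 1 N).filter Nat.Prime,
      χ p * Real.log p / (p - χ p)) atTop (𝓝 (-(deriv (LFunction χ) 1 / LFunction χ 1))) := by
  have h1 := tendsto_sum_mul_vonMangoldt_div hχ
  have h2 := (summable_mul_vonMangoldt_nonprime χ).hasSum.tendsto_sum_Icc_one (by simp)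
  have h3 := (hasSum_prime_pow χ).tendsto_sum_Icc_one (by simp)
  have h := (h1.sub h2).add h3
  rw [sub_add_cancel] at h
  refine h.congr fun N ↦ ?_
  rw [← Finset.sum_sub_distrib, ← Finset.sum_add_distrib, Finset.sum_filter]
  refine Finset.sum_congr rfl fun n _ ↦ ?_
  split_ifs with hp
  · have hp0 : (n : ℂ) ≠ 0 := by exact_mod_cast hp.ne_zero
    have hne : (n : ℂ) - χ n ≠ 0 := by
      intro h0
      have hn := χ.norm_le_one (n : ZMod q)
      rw [← sub_eq_zero.1 h0, Complex.norm_natCast] at hn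
      exact absurd hp.one_lt (not_lt.2 (by exact_mod_cast hn))
    rw [ArithmeticFunction.vonMangoldt_apply_prime hp]
    field_simp
    ring
  · simp

end DirichletCharacter

/-! ### The Kronecker character -/

theorem summable_two_mul_log_div_sq_sub_one (s : Set ℕ) :
    Summable fun n : s ↦ 2 * Real.log (n : ℕ) / (((n : ℕ) : ℝ) ^ 2 - 1) := by
  have hz := (Real.summable_nat_rpow (p := -(3 / 2))).2 (by norm_num)
  have : Summable fun n : ℕ ↦ 2 * Real.log (n : ℕ) / (((n : ℕ) : ℝ) ^ 2 - 1) := by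
    refine (hz.mul_left 8).of_norm_bounded_eventually_nat ?_
    filter_upwards [eventually_ge_atTop 2] with n hn
    have hn2 : (2 : ℝ) ≤ n := by exact_mod_cast hn
    have hn0 : (0 : ℝ) < n := by linarith
    have hlog := Real.log_le_rpow_div hn0.le one_half_pos
    have hpos : (0 : ℝ) < (n : ℝ) ^ 2 - 1 := by nlinarith
    have hlog0 := Real.log_nonneg (show (1 : ℝ) ≤ n by linarith)
    rw [Real.norm_of_nonneg (by positivity), div_le_iff₀ hpos]
    have hsplit : (n : ℝ) ^ (1 / 2 : ℝ) = (n : ℝ) ^ (-(3 / 2) : ℝ) * (n : ℝ) ^ 2 := by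
      rw [← Real.rpow_natCast, ← Real.rpow_add hn0]
      norm_num
    have hz0 : 0 ≤ (n : ℝ) ^ (-(3 / 2) : ℝ) := by positivity
    have hq : (n : ℝ) ^ 2 ≤ 2 * ((n : ℝ) ^ 2 - 1) := by nlinarith
    rw [hsplit] at hlog
    nlinarith [mul_le_mul_of_nonneg_left hq hz0]
  exact this.subtype s

section Kronecker

variable {D : ℤ}

/-- The character `χ_D` of a negative discriminant is odd. -/
theorem kroneckerSym_natAbs_sub_one (hD : D ≤ -3) (h4 : D % 4 = 0 ∨ D % 4 = 1) :
    kroneckerSym D (D.natAbs - 1) = -1 := by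
  obtain ⟨b, hb⟩ : ∃ b, b = D.natAbs := ⟨_, rfl⟩
  have hDb : D = -(b : ℤ) := by omega
  rcases h4 with h4 | h4
  -- `D ≡ -1` modulo `|D| - 1`, which is `3` modulo `4`
  · have hodd : Odd (b - 1) := Nat.odd_iff.2 (by omega)
    have hmod : D % ((b - 1 : ℕ) : ℤ) = (-1) % ((b - 1 : ℕ) : ℤ) :=
      Int.modEq_iff_dvd.2 ⟨1, by omega⟩
    rw [← hb, kroneckerSym_of_odd D hodd, jacobiSym.mod_left, hmod, ← jacobiSym.mod_left,
      jacobiSym.at_neg_one hodd, ZMod.χ₄_nat_three_mod_four (by omega)]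
  -- by reciprocity the symbol is `(-1 / |D|)`, and `|D|` is `3` modulo `4`
  · have hmod : ((b - 1 : ℕ) : ℤ) % b = (-1) % b :=
      Int.modEq_iff_dvd.2 ⟨-1, by omega⟩
    rw [kroneckerSym_eq_jacobiSym D hD h4, ← hb, jacobiSym.mod_left, hmod, ← jacobiSym.mod_left,
      jacobiSym.at_neg_one (Nat.odd_iff.2 (by omega)), ZMod.χ₄_nat_three_mod_four (by omega)]

theorem kroneckerChar_ne_one (hD : D ≤ -3) (h4 : D % 4 = 0 ∨ D % 4 = 1) :
    kroneckerChar D hD h4 ≠ 1 := by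
  intro h
  have hval := kroneckerChar_natCast D hD h4 (D.natAbs - 1)
  rw [kroneckerSym_natAbs_sub_one hD h4, h] at hval
  by_cases hu : IsUnit ((D.natAbs - 1 : ℕ) : ZMod D.natAbs)
  · rw [MulChar.one_apply hu] at hval
    norm_num at hval
  · rw [MulChar.map_nonunit _ hu] at hval
    norm_num at hval

theorem kroneckerSym_prime_trichotomy (D : ℤ) {p : ℕ} (hp : p.Prime) :
    kroneckerSym D p = 0 ∨ kroneckerSym D p = 1 ∨ kroneckerSym D p = -1 := by
  rcases eq_or_ne p 2 with rfl | h2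
  · rw [kroneckerSym_two]
    generalize (D : ZMod 8) = x
    revert x
    decide
  · rw [kroneckerSym_of_odd D (hp.odd_of_ne_two h2)]
    exact jacobiSym.trichotomy D p

end Kronecker

theorem mainTheorem5 (D : ℤ) (hD : D ≤ -3) (h4 : D % 4 = 0 ∨ D % 4 = 1) :
    DifferentiableAt ℂ (kroneckerL D hD h4) 1 ∧
    kroneckerL D hD h4 1 ≠ 0 ∧
    Summable (fun p : {p : ℕ // p.Prime ∧ kroneckerSym D p = -1} =>
      2 * Real.log (p : ℕ) / (((p : ℕ) : ℝ) ^ 2 - 1)) ∧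
    ∃ S : ℝ,
      Tendsto (fun x : ℕ => ∑ p ∈ (Finset.Icc 1 x).filter Nat.Prime,
        (kroneckerSym D p : ℝ) * Real.log p / ((p : ℝ) - 1)) atTop (𝓝 S) ∧
      -(S : ℂ) =
        deriv (kroneckerL D hD h4) 1 /
          kroneckerL D hD h4 1 +
        ((∑' p : {p : ℕ // p.Prime ∧ kroneckerSym D p = -1},
          2 * Real.log (p : ℕ) / (((p : ℕ) : ℝ) ^ 2 - 1) : ℝ) : ℂ) := by
  have : NeZero D.natAbs := ⟨by omega⟩
  have hχ := kroneckerChar_ne_one hD h4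
  have hL : kroneckerL D hD h4 = DirichletCharacter.LFunction (kroneckerChar D hD h4) := rfl
  have hsum := summable_two_mul_log_div_sq_sub_one {p : ℕ | p.Prime ∧ kroneckerSym D p = -1}
  rw [hL]
  refine ⟨DirichletCharacter.differentiable_LFunction hχ 1,
    DirichletCharacter.LFunction_apply_one_ne_zero hχ, hsum, ?_⟩
  set l := deriv (DirichletCharacter.LFunction (kroneckerChar D hD h4)) 1 /
    DirichletCharacter.LFunction (kroneckerChar D hD h4) 1 with hl
  set R : ℝ := ∑' p : {p : ℕ // p.Prime ∧ kroneckerSym D p = -1},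
    2 * Real.log (p : ℕ) / (((p : ℕ) : ℝ) ^ 2 - 1) with hR
  have hRsum : HasSum ({p : ℕ | p.Prime ∧ kroneckerSym D p = -1}.indicator
      fun n : ℕ ↦ 2 * Real.log n / ((n : ℝ) ^ 2 - 1)) R :=
    (hasSum_subtype_iff_indicator (f := fun n : ℕ ↦ 2 * Real.log n / ((n : ℝ) ^ 2 - 1))).1
      hsum.hasSum
  have h1 := DirichletCharacter.tendsto_sum_prime_mul_log_div_sub hχ
  have h2 := (Complex.hasSum_ofReal.2 hRsum).tendsto_sum_Icc_one (by simp)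
  have hlim : Tendsto (fun x : ℕ ↦ ((∑ p ∈ (Finset.Icc 1 x).filter Nat.Prime,
      (kroneckerSym D p : ℝ) * Real.log p / ((p : ℝ) - 1) : ℝ) : ℂ)) atTop (𝓝 (-l - R)) := by
    refine (h1.sub h2).congr fun N ↦ ?_
    rw [Finset.sum_filter, ← Finset.sum_sub_distrib, Finset.sum_filter]
    push_cast
    refine Finset.sum_congr rfl fun p _ ↦ ?_
    by_cases hp : p.Prime
    · have hp0 : (p : ℂ) - 1 ≠ 0 := by
        rw [sub_ne_zero]
        exact_mod_cast hp.one_lt.ne'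
      have hp1 : (p : ℂ) + 1 ≠ 0 := by exact_mod_cast Nat.succ_ne_zero p
      rw [if_pos hp, if_pos hp, kroneckerChar_natCast]
      rcases kroneckerSym_prime_trichotomy D hp with h | h | h
      · simp [h]
      · simp [h]
      -- for `χ(p) = -1`, the two sums differ by `1 / (p - 1) - 1 / (p + 1) = 2 / (p ^ 2 - 1)`
      · rw [Set.indicator_of_mem (show p ∈ {p : ℕ | p.Prime ∧ kroneckerSym D p = -1} from ⟨hp, h⟩),
          h]
        push_cast
        rw [show (p : ℂ) ^ 2 - 1 = (p - 1) * (p + 1) by ring, sub_neg_eq_add]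
        field_simp
        ring
    · rw [if_neg hp, if_neg hp, Set.indicator_of_notMem fun h ↦ hp h.1]
      simp
  have him : (-l - R).im = 0 :=
    tendsto_nhds_unique ((Complex.continuous_im.tendsto _).comp hlim)
      (tendsto_const_nhds.congr fun x ↦ (Complex.ofReal_im _).symm)
  have hre : (((-l - R).re : ℝ) : ℂ) = -l - R := Complex.ext rfl (by simpa using him.symm)
  refine ⟨(-l - R).re, ?_, ?_⟩
  · exact ((Complex.continuous_re.tendsto _).comp hlim).congr fun x ↦ Complex.ofReal_re _
  · rw [hre]
    ring
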